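/- Let $\kappa\ge 1$, let $\Sigma_\kappa=\{1,\dots,\kappa\}^{\mathbb Z}$ carry the product topology and let $\sigma$ be the left shift. Let $A:\Sigma_\kappa\to SL(3,\mathbb R)$ be a cocycle that is locally constant on cylinders of size one ($A(\omega)$ depends only on $\omega_0$), with $A^{(n)}(\omega)=A(\sigma^{n-1}\omega)\cdots A(\omega)$ and $A^{(-n)}(\omega)=(A^{(n)}(\sigma^{-n}\omega))^{-1}$ for $n\ge 1$, $A^{(0)}=I$. Assume that $A$ admits a finest one-dimensional dominated splitting: a continuous $A$-invariant splitting $\Sigma_\kappa\times\mathbb R^3=E^1\oplus E^2\oplus E^3$ into line bundles and, for $i=1,2$, constants $C>0$, $\theta\in(0,1)$ with $\|A^{(n)}(\omega)|_{E^{i+1}_\omega}\|\,\|(A^{(n)}(\omega)|_{E^i_\omega})^{-1}\|\le C\theta^n$ for all $\omega$ and $n\ge 1$. (In particular, $A$ may be any such uniformly hyperbolic cocycle with two-dimensional stable bundle.) A point $\omega$ is Lyapunov typical if there are a splitting $\mathbb R^3=F^1\oplus\dots\oplus F^k$ into non-zero subspaces and numbers $\lambda_1>\dots>\lambda_k$ such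 that $\frac1n\log\|A^{(n)}(\omega)v\|\to\lambda_i$ as $n\to+\infty$ and as $n\to-\infty$, for all $v\in F^i\setminus\{0\}$; otherwise it is Lyapunov non-typical. It is forward irregular if for some $v\ne0$ the limit of $\frac1n\log\|A^{(n)}(\omega)v\|$ as $n\to+\infty$ does not exist. The Lyapunov spectrum at $\omega$ is the set of all existing limits $\lim_{n\to+\infty}\frac1n\log\|A^{(n)}(\omega)v\|$, $v\neq 0$; it is simple if it has three elements. Cocycles $A,B$ are cohomologous if $A(\omega)=C(\sigma\omega)B(\omega)C(\omega)^{-1}$ for all $\omega$ and some map $C:\Sigma_\kappa\to SL(3,\mathbb R)$, and continuously cohomologous if $C$ can be chosen continuous. A cocycle $B$ with values in $SL(3,\mathbb R)$ is constant up to signs if $B(\omega)=\mathrm{diag}(\pm\mu_1,\pm\mu_2,\pm\mu_3)$ with distinct constants $\mu_i>0$, where only the signs may depend on $\omega$. Finally, $A$ has constant orientation if for each $i$ there are a continuous nowhere zero section $v_i$ of $E^i$ and a sign $s_i\in\{1,-1\}$ such that $A(\omega)v_i(\omega)$ is a positive multiple of $s_iv_i(\sigma\omega)$ for every $\omega$.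 (a) The following are equivalent: (1) the set of Lyapunov non-typical points of $A$ is empty; (1') the set of forward irregular points of $A$ is empty; (2) all periodic points of $\sigma$ have the same Lyapunov spectrum; (3) $A$ is continuously cohomologous to a cocycle that is constant up to signs; (3') $A$ is cohomologous to a cocycle that is constant up to signs. (b) The following are equivalent: $A$ has constant orientation and its set of Lyapunov non-typical points is empty; $A$ is continuously cohomologous to a constant cocycle with simple Lyapunov spectrum; $A$ is cohomologous to a constant cocycle with simple Lyapunov spectrum. In particular, if $A$ has constant orientation, then (1), (2) and "$A$ is cohomologous to a constant cocycle with simple Lyapunov spectrum" are equivalent. (c) If the set of Lyapunov non-typical points is non-empty (that is, if any of the properties in (a) fails), then the set of forward irregular points, and hence the set of Lyapunov non-typical points, is Baire generic (residual) in $\Sigma_\kappa$. -/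

import Mathlib

open Filter Topology

/-- The two-sided full shift space on `κ` symbols, with the product topology. -/
abbrev FullShift (κ : ℕ) : Type := ℤ → Fin κ

namespace FullShift

/-- The `n`-th power (`n ∈ ℤ`) of the left shift. -/
def shiftBy {κ : ℕ} (n : ℤ) (ω : FullShift κ) : FullShift κ := fun i => ω (i + n)

/-- The left shift `σ`. -/
def shift {κ : ℕ} (ω : FullShift κ) : FullShift κ := shiftBy 1 ω

end FullShift

open FullShift

/-- A linear cocycle over the full shift with values in `SL(d, ℝ)`. -/
abbrev LinCocycle (κ d : ℕ) : Type :=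
  FullShift κ → Matrix.SpecialLinearGroup (Fin d) ℝ

/-- The linear action of `SL(d, ℝ)` on Euclidean space `ℝ^d`. -/
noncomputable def slAct {d : ℕ} (M : Matrix.SpecialLinearGroup (Fin d) ℝ) :
    EuclideanSpace ℝ (Fin d) →ₗ[ℝ] EuclideanSpace ℝ (Fin d) :=
  Matrix.toEuclideanLin (M : Matrix (Fin d) (Fin d) ℝ)

namespace LinCocycle

variable {κ d : ℕ}

/-- `A` is locally constant on cylinders of size one: `A(ω)` depends only on `ω₀`. -/
def IsLocConst (A : LinCocycle κ d) : Prop :=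
  ∀ ω ω' : FullShift κ, ω 0 = ω' 0 → A ω = A ω'

/-- `A^{(n)}(ω) = A(σ^{n-1} ω) ⋯ A(σ ω) A(ω)` for natural `n`. -/
def iterNat (A : LinCocycle κ d) : ℕ → LinCocycle κ d
  | 0, _ => 1
  | n + 1, ω => A (shiftBy (n : ℤ) ω) * iterNat A n ω

/-- `A^{(n)}(ω)` for integers `n`, with `A^{(-n)}(ω) = (A^{(n)}(σ^{-n} ω))⁻¹`. -/
def iter (A : LinCocycle κ d) : ℤ → LinCocycle κ d
  | Int.ofNat n, ω => iterNat A n ω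
  | Int.negSucc n, ω => (iterNat A (n + 1) (shiftBy (Int.negSucc n) ω))⁻¹

/-- The finite-time exponent `(1/n) log ‖A^{(n)}(ω) v‖`, `n ∈ ℤ`. -/
noncomputable def finiteExponent (A : LinCocycle κ d) (ω : FullShift κ)
    (v : EuclideanSpace ℝ (Fin d)) (n : ℤ) : ℝ :=
  (1 / (n : ℝ)) * Real.log ‖slAct (iter A n ω) v‖

/-- `ω` is Lyapunov typical: there are a splitting `ℝ^d = E¹ ⊕ ⋯ ⊕ E^k` into non-zero subspaces
and numbers `l₁ > ⋯ > l_k` such that `(1/n) log ‖A^{(n)}(ω) v‖ → l_i` both as `n → +∞` and as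
`n → -∞`, for every non-zero `v ∈ E^i`. -/
def IsLyapunovTypical (A : LinCocycle κ d) (ω : FullShift κ) : Prop :=
  ∃ (k : ℕ) (E : Fin k → Submodule ℝ (EuclideanSpace ℝ (Fin d))) (l : Fin k → ℝ),
    DirectSum.IsInternal E ∧ (∀ i, E i ≠ ⊥) ∧ StrictAnti l ∧
    ∀ i, ∀ v ∈ E i, v ≠ 0 →
      Tendsto (finiteExponent A ω v) atTop (𝓝 (l i)) ∧
      Tendsto (finiteExponent A ω v) atBot (𝓝 (l i))

/-- The set of Lyapunov non-typical points. -/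
def nonTypical (A : LinCocycle κ d) : Set (FullShift κ) :=
  {ω | ¬ IsLyapunovTypical A ω}

/-- The set of points at which, along some direction `v`, the Lyapunov exponent is not well defined
under forward iteration. -/
def forwardIrregular (A : LinCocycle κ d) : Set (FullShift κ) :=
  {ω | ∃ v : EuclideanSpace ℝ (Fin d), v ≠ 0 ∧
    ¬ ∃ l : ℝ, Tendsto (finiteExponent A ω v) atTop (𝓝 l)}

/-- The Lyapunov spectrum at `ω`: the set of all Lyapunov exponents
`lim (1/n) log ‖A^{(n)}(ω) v‖`, `v ≠ 0`. -/
def lyapunovSpectrum (A : LinCocycle κ d) (ω : FullShift κ) : Set ℝ :=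
  {l | ∃ v : EuclideanSpace ℝ (Fin d), v ≠ 0 ∧ Tendsto (finiteExponent A ω v) atTop (𝓝 l)}

/-- The spectrum is simple: there are `d` distinct exponents, the maximal possible number. -/
def HasSimpleSpectrum (A : LinCocycle κ d) : Prop :=
  ∀ ω, (lyapunovSpectrum A ω).ncard = d

/-- All periodic points of the shift have the same Lyapunov spectrum. -/
def PeriodicSpectraAgree (A : LinCocycle κ d) : Prop :=
  ∀ ω ∈ Function.periodicPts (shift (κ := κ)), ∀ ω' ∈ Function.periodicPts (shift (κ := κ)),
    lyapunovSpectrum A ω = lyapunovSpectrum A ω'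

/-- The bundle `E` dominates the bundle `F`:
`‖A^{(n)}(ω)|_F‖ ⬝ ‖(A^{(n)}(ω)|_E)⁻¹‖ ≤ C θⁿ`, written out on vectors. -/
def Dominates (A : LinCocycle κ d)
    (E F : FullShift κ → Submodule ℝ (EuclideanSpace ℝ (Fin d))) : Prop :=
  ∃ C θ : ℝ, 0 < C ∧ 0 < θ ∧ θ < 1 ∧ ∀ n : ℕ, 1 ≤ n → ∀ ω, ∀ v ∈ E ω, ∀ w ∈ F ω,
    ‖slAct (iterNat A n ω) w‖ * ‖v‖ ≤ C * θ ^ n * (‖slAct (iterNat A n ω) v‖ * ‖w‖)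

/-- `E⁰ ⊕ ⋯ ⊕ E^{d-1}` is a finest dominated splitting into one-dimensional subbundles:
a continuous `A`-invariant splitting into lines, each dominating the next one.
Continuity of a subbundle is continuity of the orthogonal projection onto it. -/
structure IsFinestDominatedSplitting (A : LinCocycle κ d)
    (E : Fin d → FullShift κ → Submodule ℝ (EuclideanSpace ℝ (Fin d))) : Prop where
  one_dim : ∀ i ω, Module.finrank ℝ (E i ω) = 1
  splits : ∀ ω, DirectSum.IsInternal (fun i => E i ω)
  continuous : ∀ i, Continuous fun ω => (E i ω).starProjection
  invariant : ∀ i ω, (E i ω).map (slAct (A ω)) = E i (shift ω)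
  dominated : ∀ i j : Fin d, (i : ℕ) + 1 = j → Dominates A (E i) (E j)

/-- `A` acts on each line bundle `E^i` with a constant orientation character: there are a
continuous nowhere zero section `v_i` of `E^i` and a sign `s_i = ±1` such that
`A(ω) v_i(ω)` is a positive multiple of `s_i v_i(σ ω)` for all `ω`. -/
def HasConstantOrientation (A : LinCocycle κ d)
    (E : Fin d → FullShift κ → Submodule ℝ (EuclideanSpace ℝ (Fin d))) : Prop :=
  ∀ i, ∃ (v : FullShift κ → EuclideanSpace ℝ (Fin d)) (s : ℝ),
    Continuous v ∧ (∀ ω, v ω ∈ E i ω ∧ v ω ≠ 0) ∧ (s = 1 ∨ s = -1) ∧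
    ∀ ω, ∃ a : ℝ, 0 < a ∧ slAct (A ω) (v ω) = (s * a) • v (shift ω)

/-- `A(ω) = C(σ ω) B(ω) C(ω)⁻¹` for some `C : Σ → SL(d, ℝ)`, of no particular regularity. -/
def Cohomologous (A B : LinCocycle κ d) : Prop :=
  ∃ C : LinCocycle κ d, ∀ ω, A ω = C (shift ω) * B ω * (C ω)⁻¹

/-- `A(ω) = C(σ ω) B(ω) C(ω)⁻¹` for some continuous `C : Σ → SL(d, ℝ)`. -/
def ContCohomologous (A B : LinCocycle κ d) : Prop :=
  ∃ C : LinCocycle κ d, Continuous C ∧ ∀ ω, A ω = C (shift ω) * B ω * (C ω)⁻¹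

/-- `B` is diagonal with entries `±μ_i`, where `μ_1, …, μ_d > 0` are distinct constants and only the
signs may depend on `ω`. -/
def IsConstUpToSigns (B : LinCocycle κ d) : Prop :=
  ∃ μ : Fin d → ℝ, (∀ i, 0 < μ i) ∧ Function.Injective μ ∧
    ∀ ω i j, |(B ω : Matrix (Fin d) (Fin d) ℝ) i j| = Matrix.diagonal μ i j

end LinCocycle

/-!
In a continuous frame adapted to the dominated splitting, `A` becomes a diagonal cocycle `D`. If two
periodic points have different spectra, the Birkhoff averages of some `log |D_ii|` tend to different
limits on two dense sets (points whose future is eventually periodic), so they diverge generically.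

If the periodic spectra agree, every `|D_ii|` has constant multipliers over periodic orbits, and it
must be shown to be cohomologous to that constant. The transfer function is the inverse of the
`i`-th diagonal entry of `C(p)⁻¹ C(ω)`, where `C` is the frame and `p` a fixed point: because `A`
depends on one symbol, closing up homoclinic orbits of `p` into periodic ones turns the hypothesis
on multipliers into a cohomological identity for this entry, provided that the `i`-th entry of `D`
dominates all others. This covers the first line; the inverse transpose cocycle covers the last one,
and the determinant the middle one, which is where dimension three enters. The same argument without
absolute values gives the statement on constant cocycles.
-/

namespace FullShift

variable {κ : ℕ}

@[simp] theorem shiftBy_apply (n : ℤ) (ω : FullShift κ) (i : ℤ) : shiftBy n ω i = ω (i + n) := rfl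

@[simp] theorem shiftBy_zero (ω : FullShift κ) : shiftBy 0 ω = ω := by
  funext i; simp

theorem shiftBy_shiftBy (m n : ℤ) (ω : FullShift κ) :
    shiftBy m (shiftBy n ω) = shiftBy (m + n) ω := by
  funext i; simp [add_assoc]

theorem shift_shiftBy (n : ℤ) (ω : FullShift κ) : shift (shiftBy n ω) = shiftBy (n + 1) ω := by
  rw [shift, shiftBy_shiftBy, add_comm]

theorem shift_iterate (n : ℕ) (ω : FullShift κ) : shift^[n] ω = shiftBy n ω := by
  induction n with
  | zero => simp
  | succ n ih => rw [Function.iterate_succ_apply', ih, shift_shiftBy]; push_cast; rfl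

theorem isPeriodicPt_shift_iff {N : ℕ} {p : FullShift κ} :
    Function.IsPeriodicPt shift N p ↔ shiftBy N p = p := by
  rw [Function.IsPeriodicPt, Function.IsFixedPt, shift_iterate]

theorem finite_range_shiftBy {N : ℕ} (hN : 0 < N) {p : FullShift κ}
    (hp : Function.IsPeriodicPt shift N p) : (Set.range fun n : ℤ => shiftBy n p).Finite := by
  have hper : Function.Periodic (fun n : ℤ => shiftBy n p) (N : ℤ) := fun n => by
    change shiftBy (n + N) p = shiftBy n p
    rw [← shiftBy_shiftBy, isPeriodicPt_shift_iff.mp hp]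
  refine ((Set.finite_Ico (0 : ℤ) N).image fun n => shiftBy n p).subset ?_
  rintro _ ⟨n, rfl⟩
  obtain ⟨m, hm, h⟩ := hper.exists_mem_Ico₀ (by exact_mod_cast hN) n
  exact ⟨m, hm, h.symm⟩

theorem continuous_shiftBy (n : ℤ) : Continuous (shiftBy n : FullShift κ → FullShift κ) :=
  continuous_pi fun i => continuous_apply (i + n)

theorem continuous_shift : Continuous (shift : FullShift κ → FullShift κ) := continuous_shiftBy 1

/-- The sequence equal to `ω` to the left of `m` and to `ω'` from `m` on. -/
def splice (m : ℤ) (ω ω' : FullShift κ) : FullShift κ := fun j => if j < m then ω j else ω' j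

theorem splice_of_lt {m j : ℤ} (ω ω' : FullShift κ) (h : j < m) : splice m ω ω' j = ω j :=
  if_pos h

theorem splice_of_le {m j : ℤ} (ω ω' : FullShift κ) (h : m ≤ j) : splice m ω ω' j = ω' j :=
  if_neg (not_lt.mpr h)

theorem tendsto_of_eventually_eq {ι : Type*} {l : Filter ι} {x : ι → FullShift κ} {ω : FullShift κ}
    (h : ∀ j, ∀ᶠ n in l, x n j = ω j) : Tendsto x l (𝓝 ω) :=
  tendsto_pi_nhds.mpr fun j =>
    tendsto_const_nhds.congr' ((h j).mono fun _ hn => hn.symm)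

theorem tendsto_splice_natCast (ω ω' : FullShift κ) :
    Tendsto (fun n : ℕ => splice n ω ω') atTop (𝓝 ω) := by
  refine tendsto_of_eventually_eq fun j => ?_
  filter_upwards [eventually_gt_atTop j.toNat] with n hn
  exact splice_of_lt _ _ (by omega)

theorem tendsto_splice_neg_natCast (ω ω' : FullShift κ) :
    Tendsto (fun n : ℕ => splice (-n) ω' ω) atTop (𝓝 ω) := by
  refine tendsto_of_eventually_eq fun j => ?_
  filter_upwards [eventually_gt_atTop (-j).toNat] with n hn
  exact splice_of_le _ _ (by omega)

theorem dense_setOf_eventually_future_eq (p : FullShift κ) :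
    Dense {ω : FullShift κ | ∃ m : ℕ, ∀ j ≥ (m : ℤ), ω j = p j} := fun ω =>
  mem_closure_of_tendsto (tendsto_splice_natCast ω p)
    (Eventually.of_forall fun m => ⟨m, fun _ hj => splice_of_le _ _ hj⟩)

theorem dense_setOf_eventually_past_eq (p : FullShift κ) :
    Dense {ω : FullShift κ | ∃ m : ℕ, ∀ j < -(m : ℤ), ω j = p j} := fun ω =>
  mem_closure_of_tendsto (tendsto_splice_neg_natCast ω p)
    (Eventually.of_forall fun m => ⟨m, fun _ hj => splice_of_lt _ _ hj⟩)

/-- The fixed point of the shift that repeats the symbol `s`. -/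
def constSeq (s : Fin κ) : FullShift κ := fun _ => s

theorem shiftBy_constSeq (n : ℤ) (s : Fin κ) : shiftBy n (constSeq s) = constSeq s := rfl

/-- The sequence of period `L` that repeats the symbols of `ω` at the places `0, …, L - 1`. -/
def periodize (L : ℕ) (ω : FullShift κ) : FullShift κ := fun j => ω (j % L)

theorem isPeriodicPt_periodize (L : ℕ) (ω : FullShift κ) :
    Function.IsPeriodicPt shift L (periodize L ω) :=
  isPeriodicPt_shift_iff.mpr (funext fun j => congrArg ω (Int.add_emod_right j L))

theorem periodize_of_mem {L : ℕ} (ω : FullShift κ) {j : ℤ} (h0 : 0 ≤ j) (hL : j < L) :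
    periodize L ω j = ω j :=
  congrArg ω (Int.emod_eq_of_lt h0 hL)

theorem tendsto_periodize_constSeq {s : Fin κ} {ω : FullShift κ} {m : ℕ}
    (hpast : ∀ j < 0, ω j = s) (hfuture : ∀ j ≥ (m : ℤ), ω j = s) :
    Tendsto (fun n : ℕ => periodize (n + m + n) (shiftBy (-n) ω)) atTop (𝓝 (constSeq s)) := by
  refine tendsto_of_eventually_eq fun j => ?_
  filter_upwards [eventually_gt_atTop j.natAbs] with n hn
  rcases lt_or_ge j 0 with hj | hj
  · have hmod : j % ((n + m + n : ℕ) : ℤ) = j + (n + m + n : ℕ) := by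
      rw [← Int.add_emod_right, Int.emod_eq_of_lt (by omega) (by omega)]
    exact hfuture _ (by omega)
  · rw [periodize_of_mem _ hj (by omega)]
    exact hpast _ (by omega)

end FullShift

section SlAct

variable {d : ℕ}

theorem slAct_apply (M : Matrix.SpecialLinearGroup (Fin d) ℝ) (v : EuclideanSpace ℝ (Fin d))
    (i : Fin d) : slAct M v i = ∑ j, M i j * v j := rfl

theorem slAct_one (v : EuclideanSpace ℝ (Fin d)) : slAct 1 v = v := by
  simp [slAct, Matrix.toLpLin_one]

theorem slAct_mul (M N : Matrix.SpecialLinearGroup (Fin d) ℝ) (v : EuclideanSpace ℝ (Fin d)) :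
    slAct (M * N) v = slAct M (slAct N v) := by
  simp [slAct, Matrix.toLpLin_mul_same]

theorem slAct_inv_slAct (M : Matrix.SpecialLinearGroup (Fin d) ℝ) (v : EuclideanSpace ℝ (Fin d)) :
    slAct M⁻¹ (slAct M v) = v := by
  rw [← slAct_mul, inv_mul_cancel, slAct_one]

theorem slAct_slAct_inv (M : Matrix.SpecialLinearGroup (Fin d) ℝ) (v : EuclideanSpace ℝ (Fin d)) :
    slAct M (slAct M⁻¹ v) = v := by
  rw [← slAct_mul, mul_inv_cancel, slAct_one]

theorem slAct_ne_zero (M : Matrix.SpecialLinearGroup (Fin d) ℝ) {v : EuclideanSpace ℝ (Fin d)}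
    (hv : v ≠ 0) : slAct M v ≠ 0 := fun h => hv (by rw [← slAct_inv_slAct M v, h, map_zero])

theorem slAct_single (M : Matrix.SpecialLinearGroup (Fin d) ℝ) (i j : Fin d) :
    slAct M (EuclideanSpace.single i 1) j = M j i := by
  simp [slAct_apply]

theorem continuous_slEntry (i j : Fin d) :
    Continuous fun M : Matrix.SpecialLinearGroup (Fin d) ℝ => M i j :=
  (continuous_subtype_val (p := fun M : Matrix (Fin d) (Fin d) ℝ => M.det = 1)).matrix_elem i j

variable {ι : Type*} {l : Filter ι} {K : Set (Matrix.SpecialLinearGroup (Fin d) ℝ)}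
  {M : ι → Matrix.SpecialLinearGroup (Fin d) ℝ}

theorem isBigO_slEntry_of_isCompact (hK : IsCompact K) (hM : ∀ n, M n ∈ K) (i j : Fin d) :
    (fun n => M n i j) =O[l] fun _ => (1 : ℝ) := by
  obtain ⟨c, hc⟩ := hK.exists_bound_of_continuousOn (continuous_slEntry i j).continuousOn
  exact .of_bound c (Eventually.of_forall fun n => by simpa using hc _ (hM n))

theorem isBigO_slAct_of_isCompact (hK : IsCompact K) (hM : ∀ n, M n ∈ K)
    (v : ι → EuclideanSpace ℝ (Fin d)) : (fun n => slAct (M n) (v n)) =O[l] v := by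
  have hcont : Continuous fun M : Matrix.SpecialLinearGroup (Fin d) ℝ =>
      Matrix.toEuclideanCLM (n := Fin d) (𝕜 := ℝ) M.1 :=
    (LinearMap.continuous_of_finiteDimensional
      (Matrix.toEuclideanCLM (n := Fin d) (𝕜 := ℝ)).toAlgEquiv.toLinearMap).comp
      continuous_subtype_val
  obtain ⟨c, hc⟩ := hK.exists_bound_of_continuousOn hcont.continuousOn
  exact .of_bound c (Eventually.of_forall fun n =>
    (Matrix.toEuclideanCLM (n := Fin d) (𝕜 := ℝ) (M n).1).le_of_opNorm_le (hc _ (hM n)) (v n))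

theorem isTheta_slAct_of_isCompact (hK : IsCompact K) (hM : ∀ n, M n ∈ K)
    (v : ι → EuclideanSpace ℝ (Fin d)) : (fun n => slAct (M n) (v n)) =Θ[l] v := by
  refine ⟨isBigO_slAct_of_isCompact hK hM v, ?_⟩
  simpa only [slAct_inv_slAct] using isBigO_slAct_of_isCompact (l := l) hK.inv
    (fun n => Set.inv_mem_inv.mpr (hM n)) fun n => slAct (M n) (v n)

end SlAct

section Exponents

variable {V W : Type*} [NormedAddCommGroup V] [NormedAddCommGroup W] {l : Filter ℤ}
  {f : ℤ → V} {g : ℤ → W} {a b : ℝ}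

/-- The vectors `f n` grow at the exponential rate `a` along `l`. -/
def HasExponent (f : ℤ → V) (l : Filter ℤ) (a : ℝ) : Prop :=
  Tendsto (fun n : ℤ => 1 / (n : ℝ) * Real.log ‖f n‖) l (𝓝 a)

theorem hasExponent_atTop_iff :
    HasExponent f atTop a ↔
      Tendsto (fun n : ℕ => (n : ℝ)⁻¹ * Real.log ‖f n‖) atTop (𝓝 a) := by
  rw [HasExponent, ← Nat.map_cast_int_atTop, tendsto_map'_iff]
  simp only [Function.comp_def, Int.cast_natCast, one_div]

theorem tendsto_one_div_intCast_cofinite : Tendsto (fun n : ℤ => 1 / (n : ℝ)) cofinite (𝓝 0) := by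
  simp only [one_div]
  refine tendsto_inv₀_cobounded.comp ?_
  rw [Metric.cobounded_eq_cocompact]
  exact Int.tendsto_coe_cofinite

theorem isBigO_log_norm_sub_of_isTheta (h : g =Θ[l] f) :
    (fun n => Real.log ‖g n‖ - Real.log ‖f n‖) =O[l] fun _ => (1 : ℝ) := by
  obtain ⟨c, hc, hgf⟩ := h.1.exists_pos
  obtain ⟨c', hc', hfg⟩ := h.2.exists_pos
  refine .of_bound (max |Real.log c| |Real.log c'|) ?_
  filter_upwards [hgf.bound, hfg.bound] with n hg hf
  rcases (norm_nonneg (f n)).eq_or_lt with hf0 | hf0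
  · have hg0 : ‖g n‖ = 0 := le_antisymm (by simpa [← hf0] using hg) (norm_nonneg _)
    simp [hg0, ← hf0]
  have hg0 : 0 < ‖g n‖ := pos_of_mul_pos_right (hf0.trans_le hf) hc'.le
  have h1 := Real.log_le_log hg0 hg
  have h2 := Real.log_le_log hf0 hf
  rw [Real.log_mul hc.ne' hf0.ne'] at h1
  rw [Real.log_mul hc'.ne' hg0.ne'] at h2
  rw [norm_one, mul_one, Real.norm_eq_abs, abs_le']
  exact ⟨le_max_of_le_left ((by linarith : _ ≤ Real.log c).trans (le_abs_self _)),
    le_max_of_le_right ((by linarith : _ ≤ Real.log c').trans (le_abs_self _))⟩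

theorem HasExponent.of_isTheta (hf : HasExponent f l a) (hl : l ≤ cofinite) (h : g =Θ[l] f) :
    HasExponent g l a := by
  have hdiff : Tendsto (fun n : ℤ => 1 / (n : ℝ) * (Real.log ‖g n‖ - Real.log ‖f n‖)) l (𝓝 0) := by
    refine Asymptotics.IsBigO.trans_tendsto ?_ (tendsto_one_div_intCast_cofinite.mono_left hl)
    simpa using (Asymptotics.isBigO_refl (fun n : ℤ => 1 / (n : ℝ)) l).mul
      (isBigO_log_norm_sub_of_isTheta h)
  simpa only [HasExponent, mul_sub, sub_add_cancel, zero_add] using hdiff.add hf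

theorem hasExponent_congr (hl : l ≤ cofinite) (h : g =Θ[l] f) :
    HasExponent g l a ↔ HasExponent f l a :=
  ⟨fun hg => hg.of_isTheta hl h.symm, fun hf => hf.of_isTheta hl h⟩

theorem HasExponent.isLittleO (hg : HasExponent g atTop b) (hf : HasExponent f atTop a)
    (hba : b < a) (hf0 : ∀ n, f n ≠ 0) : g =o[atTop] f := by
  have hlog : Tendsto (fun n : ℤ => Real.log ‖g n‖ - Real.log ‖f n‖) atTop atBot := by
    refine ((tendsto_intCast_atTop_atTop (R := ℝ)).atTop_mul_neg (sub_neg.mpr hba)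
      (hg.sub hf)).congr' ?_
    filter_upwards [eventually_gt_atTop 0] with n hn
    have : (n : ℝ) ≠ 0 := by exact_mod_cast hn.ne'
    field_simp
  refine Asymptotics.isLittleO_iff.mpr fun c hc => ?_
  filter_upwards [hlog.eventually_le_atBot (Real.log c)] with n hn
  have hfn : 0 < ‖f n‖ := norm_pos_iff.mpr (hf0 n)
  rcases (norm_nonneg (g n)).eq_or_lt with hg0 | hg0
  · rw [← hg0]; positivity
  · rw [← Real.log_le_log_iff hg0 (by positivity), Real.log_mul hc.ne' hfn.ne']
    linarith

theorem exists_hasExponent_sum {ι : Type*} {s : Finset ι} (hs : s.Nonempty) {x : ι → ℤ → W}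
    {a : ι → ℝ} (ha : Set.InjOn a s) (hx0 : ∀ i ∈ s, ∀ n, x i n ≠ 0)
    (hx : ∀ i ∈ s, HasExponent (x i) atTop (a i)) :
    ∃ i ∈ s, HasExponent (∑ j ∈ s, x j) atTop (a i) := by
  classical
  obtain ⟨i, hi, hmax⟩ := s.exists_max_image a hs
  have hrest : (∑ j ∈ s.erase i, x j) =o[atTop] x i := .sum fun j hj => by
    obtain ⟨hji, hj⟩ := Finset.mem_erase.mp hj
    exact (hx j hj).isLittleO (hx i hi) ((hmax j hj).lt_of_ne (ha.ne hj hi hji)) (hx0 i hi)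
  refine ⟨i, hi, (hx i hi).of_isTheta atTop_le_cofinite ?_⟩
  rw [← Finset.add_sum_erase s x hi]
  exact hrest.right_isTheta_add'.symm

end Exponents

section Baire

variable {X Y : Type*} [TopologicalSpace X] [TopologicalSpace Y] {f : ℕ → X → Y}

theorem residual_setOf_frequently_mem (hf : ∀ n, Continuous (f n)) {U : Set Y} (hU : IsOpen U)
    (hd : Dense {x | ∃ᶠ n in atTop, f n x ∈ U}) :
    {x | ∃ᶠ n in atTop, f n x ∈ U} ∈ residual X := by
  have heq : {x | ∃ᶠ n in atTop, f n x ∈ U} = ⋂ N, ⋃ n ≥ N, f n ⁻¹' U := by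
    ext x; simp [frequently_atTop]
  rw [heq] at hd ⊢
  refine countable_iInter_mem.mpr fun N => residual_of_dense_open ?_
    (hd.mono (Set.iInter_subset _ N))
  exact isOpen_iUnion fun n => isOpen_iUnion fun _ => hU.preimage (hf n)

theorem residual_setOf_mapClusterPt [FirstCountableTopology Y] (hf : ∀ n, Continuous (f n)) {y : Y}
    (hd : Dense {x | Tendsto (f · x) atTop (𝓝 y)}) :
    {x | MapClusterPt y atTop (f · x)} ∈ residual X := by
  obtain ⟨u, hu⟩ := (𝓝 y).exists_antitone_basis
  have hU : ∀ k, interior (u k) ∈ 𝓝 y := fun k => interior_mem_nhds.mpr (hu.mem k)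
  have hres : ∀ k, {x | ∃ᶠ n in atTop, f n x ∈ interior (u k)} ∈ residual X := fun k =>
    residual_setOf_frequently_mem hf isOpen_interior
      (hd.mono fun x hx => (hx.eventually (hU k)).frequently)
  filter_upwards [countable_iInter_mem.mpr hres] with x hx
  exact hu.1.mapClusterPt_iff_frequently.mpr fun k _ =>
    (Set.mem_iInter.mp hx k).mono fun n hn => interior_subset hn

theorem residual_setOf_not_tendsto [T2Space Y] [FirstCountableTopology Y]
    (hf : ∀ n, Continuous (f n)) {y y' : Y} (hne : y ≠ y')
    (hy : Dense {x | Tendsto (f · x) atTop (𝓝 y)})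
    (hy' : Dense {x | Tendsto (f · x) atTop (𝓝 y')}) :
    {x | ¬ ∃ l, Tendsto (f · x) atTop (𝓝 l)} ∈ residual X := by
  filter_upwards [residual_setOf_mapClusterPt hf hy, residual_setOf_mapClusterPt hf hy']
    with x hx hx'
  rintro ⟨l, hl⟩
  have hlim : ∀ {z}, MapClusterPt z atTop (f · x) → z = l := fun hz =>
    eq_of_nhds_neBot (ClusterPt.mono hz hl)
  exact hne ((hlim hx).trans (hlim hx').symm)

theorem continuous_birkhoffAverage {T : X → X} (hT : Continuous T) {φ : X → ℝ} (hφ : Continuous φ)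
    (n : ℕ) : Continuous (birkhoffAverage ℝ T φ n) := by
  have hsum : Continuous (birkhoffSum T φ n) :=
    continuous_finsetSum (Finset.range n) fun k _ => hφ.comp (hT.iterate k)
  exact hsum.const_smul (n : ℝ)⁻¹

end Baire

section Birkhoff

variable {X : Type*} {T : X → X} {φ : X → ℝ}

theorem tendsto_birkhoffAverage_of_tendsto_sub {x y : X} {a : ℝ}
    (hxy : Tendsto (fun n => φ (T^[n] x) - φ (T^[n] y)) atTop (𝓝 0))
    (hy : Tendsto (birkhoffAverage ℝ T φ · y) atTop (𝓝 a)) :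
    Tendsto (birkhoffAverage ℝ T φ · x) atTop (𝓝 a) := by
  have hsum := hxy.cesaro.add hy
  simpa only [birkhoffAverage, birkhoffSum, Finset.sum_sub_distrib, smul_eq_mul, mul_sub,
    sub_add_cancel, zero_add] using hsum

theorem birkhoffSum_sub_mul_average_periodic {N : ℕ} (hN : 0 < N) {p : X}
    (hp : Function.IsPeriodicPt T N p) :
    Function.Periodic (fun n : ℕ => birkhoffSum T φ n p - n * birkhoffAverage ℝ T φ N p) N := by
  intro n
  have hN' : (N : ℝ) ≠ 0 := by exact_mod_cast hN.ne'
  simp only [add_comm n N, birkhoffSum_add, hp.eq, birkhoffAverage, smul_eq_mul]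
  push_cast
  field_simp
  ring

theorem tendsto_birkhoffAverage_of_isPeriodicPt {N : ℕ} (hN : 0 < N) {p : X}
    (hp : Function.IsPeriodicPt T N p) :
    Tendsto (birkhoffAverage ℝ T φ · p) atTop (𝓝 (birkhoffAverage ℝ T φ N p)) := by
  set a := birkhoffAverage ℝ T φ N p
  have hper := birkhoffSum_sub_mul_average_periodic (φ := φ) hN hp
  have hbdd : (fun n : ℕ => birkhoffSum T φ n p - n * a) =O[atTop] fun _ => (1 : ℝ) := by
    refine .of_bound (∑ k ∈ Finset.range N, ‖birkhoffSum T φ k p - k * a‖)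
      (Eventually.of_forall fun n => ?_)
    rw [norm_one, mul_one, ← hper.map_mod_nat n]
    exact Finset.single_le_sum (f := fun k : ℕ => ‖birkhoffSum T φ k p - k * a‖)
      (fun _ _ => norm_nonneg _) (Finset.mem_range.mpr (Nat.mod_lt n hN))
  have hdiff : Tendsto (fun n : ℕ => (n : ℝ)⁻¹ * (birkhoffSum T φ n p - n * a)) atTop (𝓝 0) := by
    refine Asymptotics.IsBigO.trans_tendsto ?_ (tendsto_inv_atTop_nhds_zero_nat (𝕜 := ℝ))
    simpa using (Asymptotics.isBigO_refl (fun n : ℕ => (n : ℝ)⁻¹) atTop).mul hbdd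
  refine (zero_add a ▸ hdiff.add_const a).congr' ?_
  filter_upwards [eventually_ne_atTop 0] with n hn
  rw [birkhoffAverage, smul_eq_mul]
  field_simp
  ring

end Birkhoff

section Diagonal

theorem isDiag_mul {n α : Type*} [Fintype n] [NonUnitalNonAssocSemiring α]
    {M N : Matrix n n α} (hM : M.IsDiag) (hN : N.IsDiag) : (M * N).IsDiag := by
  classical
  rw [← hM.diagonal_diag, ← hN.diagonal_diag, Matrix.diagonal_mul_diagonal]
  exact Matrix.isDiag_diagonal _

variable {n : Type*} [Fintype n] [DecidableEq n]

section CommRing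

variable {R : Type*} [CommRing R] {D : Matrix.SpecialLinearGroup n R} (hD : D.1.IsDiag)

include hD

theorem slEntry_mul_of_isDiag_left (M : Matrix.SpecialLinearGroup n R) (i j : n) :
    (D * M) i j = D i i * M i j := by
  rw [Matrix.SpecialLinearGroup.coe_mul, ← hD.diagonal_diag, Matrix.diagonal_mul,
    hD.diagonal_diag, Matrix.diag_apply]

theorem slEntry_mul_of_isDiag_right (M : Matrix.SpecialLinearGroup n R) (i j : n) :
    (M * D) i j = M i j * D j j := by
  rw [Matrix.SpecialLinearGroup.coe_mul, ← hD.diagonal_diag, Matrix.mul_diagonal,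
    hD.diagonal_diag, Matrix.diag_apply]

theorem prod_slEntry_of_isDiag : ∏ i, D i i = 1 := by
  have hdet := D.det_coe
  rwa [← hD.diagonal_diag, Matrix.det_diagonal] at hdet

end CommRing

variable {𝕜 : Type*} [Field 𝕜] {D : Matrix.SpecialLinearGroup n 𝕜} (hD : D.1.IsDiag)

include hD

theorem slEntry_ne_zero_of_isDiag (i : n) : D i i ≠ 0 := by
  have hprod : ∏ i, D i i ≠ 0 := by rw [prod_slEntry_of_isDiag hD]; exact one_ne_zero
  exact Finset.prod_ne_zero_iff.mp hprod i (Finset.mem_univ i)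

theorem isDiag_slInv : (D⁻¹).1.IsDiag := fun i j hij => by
  have h := slEntry_mul_of_isDiag_right hD D⁻¹ i j
  rw [inv_mul_cancel, Matrix.SpecialLinearGroup.coe_one, Matrix.one_apply_ne hij] at h
  exact (mul_eq_zero.mp h.symm).resolve_right (slEntry_ne_zero_of_isDiag hD j)

theorem slEntry_inv_of_isDiag (i : n) : D⁻¹ i i = (D i i)⁻¹ := by
  have h := slEntry_mul_of_isDiag_right hD D⁻¹ i i
  rw [inv_mul_cancel, Matrix.SpecialLinearGroup.coe_one, Matrix.one_apply_eq] at h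
  exact eq_inv_of_mul_eq_one_left h.symm

end Diagonal

theorem slAct_single_of_isDiag {d : ℕ} {D : Matrix.SpecialLinearGroup (Fin d) ℝ}
    (hD : D.1.IsDiag) (i : Fin d) (t : ℝ) :
    slAct D (EuclideanSpace.single i t) = D i i • EuclideanSpace.single i t := by
  ext j
  rcases eq_or_ne j i with rfl | hji
  · simp [slAct_apply]
  · simp [slAct_apply, hD hji, hji]

section

variable {d : ℕ} {l : Filter ℤ} {a : ℝ}

theorem hasExponent_slAct_single_iff (hl : l ≤ cofinite)
    {D : ℤ → Matrix.SpecialLinearGroup (Fin d) ℝ} (hD : ∀ n, (D n).1.IsDiag) (i : Fin d) {t : ℝ}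
    (ht : t ≠ 0) :
    HasExponent (fun n => slAct (D n) (EuclideanSpace.single i t)) l a ↔
      HasExponent (fun n => D n i i) l a := by
  refine hasExponent_congr hl (Asymptotics.IsTheta.of_norm_left ?_)
  simp only [slAct_single_of_isDiag (hD _), norm_smul, PiLp.norm_single]
  exact ((Asymptotics.isTheta_refl _ l).norm_left.mul
    (Asymptotics.isTheta_const_const (norm_ne_zero_iff.mpr ht) one_ne_zero)).trans_eventuallyEq
    (Eventually.of_forall fun n => mul_one _)

theorem exists_hasExponent_slAct_sum {ι : Type*} [Fintype ι] {b : ι → ℝ}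
    (hb : Function.Injective b) {M : ℤ → Matrix.SpecialLinearGroup (Fin d) ℝ}
    {v : ι → EuclideanSpace ℝ (Fin d)} (hv : ∑ i, v i ≠ 0)
    (hM : ∀ i, v i ≠ 0 → HasExponent (fun n => slAct (M n) (v i)) atTop (b i)) :
    ∃ i, HasExponent (fun n => slAct (M n) (∑ i, v i)) atTop (b i) := by
  classical
  have hs : (Finset.univ.filter fun i => v i ≠ 0).Nonempty :=
    Finset.nonempty_of_sum_ne_zero (by rwa [Finset.sum_filter_ne_zero])
  obtain ⟨i, -, hi⟩ := exists_hasExponent_sum hs (x := fun i n => slAct (M n) (v i)) hb.injOn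
    (fun i hi n => slAct_ne_zero _ (Finset.mem_filter.mp hi).2)
    fun i hi => hM i (Finset.mem_filter.mp hi).2
  refine ⟨i, ?_⟩
  convert hi using 2 with n
  rw [Finset.sum_apply, ← map_sum, Finset.sum_filter_ne_zero]

end

namespace LinCocycle

variable {κ d : ℕ}

theorem forwardIrregular_subset_nonTypical (A : LinCocycle κ d) :
    A.forwardIrregular ⊆ A.nonTypical := by
  rintro ω ⟨v, hv, hirr⟩ ⟨k, F, l, hF, -, hl, hlim⟩
  have hvF : v ∈ ⨆ i, F i := hF.submodule_iSup_eq_top ▸ Submodule.mem_top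
  obtain ⟨f, hf, rfl⟩ := (Submodule.mem_iSup_iff_exists_finsupp F v).mp hvF
  rw [Finsupp.sum_fintype _ _ fun _ => rfl] at hv hirr
  obtain ⟨i, hi⟩ := exists_hasExponent_slAct_sum hl.injective hv
    fun i hi => (hlim i (f i) (hf i) hi).1
  exact hirr ⟨l i, hi⟩

theorem iterNat_zero (A : LinCocycle κ d) (ω : FullShift κ) : iterNat A 0 ω = 1 := rfl

theorem iterNat_succ (A : LinCocycle κ d) (n : ℕ) (ω : FullShift κ) :
    iterNat A (n + 1) ω = A (shiftBy n ω) * iterNat A n ω := rfl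

theorem iterNat_one (A : LinCocycle κ d) (ω : FullShift κ) : iterNat A 1 ω = A ω := by
  simp [iterNat_succ, iterNat_zero]

theorem iterNat_add (A : LinCocycle κ d) (m n : ℕ) (ω : FullShift κ) :
    iterNat A (m + n) ω = iterNat A m (shiftBy n ω) * iterNat A n ω := by
  induction m with
  | zero => simp [iterNat_zero]
  | succ m ih =>
    rw [Nat.succ_add, iterNat_succ, iterNat_succ, ih, shiftBy_shiftBy, mul_assoc]
    push_cast; rfl

theorem IsLocConst.iterNat_congr {A : LinCocycle κ d} (hA : A.IsLocConst) (n : ℕ)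
    {ω ω' : FullShift κ} (h : ∀ j : ℤ, 0 ≤ j → j < n → ω j = ω' j) :
    iterNat A n ω = iterNat A n ω' := by
  induction n with
  | zero => rfl
  | succ n ih =>
    rw [iterNat_succ, iterNat_succ, ih fun j h0 h1 => h j h0 (by push_cast; omega),
      hA (shiftBy n ω) (shiftBy n ω') (by simpa using h n (by omega) (by push_cast; omega))]

theorem IsLocConst.continuous {A : LinCocycle κ d} (hA : A.IsLocConst) : Continuous A := by
  have h : A = (fun s => A fun _ => s) ∘ fun ω : FullShift κ => ω 0 :=
    funext fun ω => hA _ _ rfl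
  rw [h]
  exact continuous_of_discreteTopology.comp (continuous_apply 0)

/-- `C` is a transfer map from `B` to `A`, that is, `A ω = C (shift ω) * B ω * (C ω)⁻¹`, written
without inverses. -/
def IsTransfer (C A B : LinCocycle κ d) : Prop :=
  ∀ ω, A ω * C ω = C (shift ω) * B ω

section Transfer

variable {A B C : LinCocycle κ d}

theorem isTransfer_iff : IsTransfer C A B ↔ ∀ ω, A ω = C (shift ω) * B ω * (C ω)⁻¹ :=
  forall_congr' fun _ => eq_mul_inv_iff_mul_eq.symm

namespace IsTransfer

theorem iterNat (h : IsTransfer C A B) (n : ℕ) (ω : FullShift κ) :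
    iterNat A n ω * C ω = C (shiftBy n ω) * iterNat B n ω := by
  induction n with
  | zero => simp [iterNat_zero]
  | succ n ih =>
    rw [iterNat_succ, iterNat_succ, mul_assoc, ih, ← mul_assoc, h, shift_shiftBy, mul_assoc]
    push_cast; rfl

theorem iter (h : IsTransfer C A B) (n : ℤ) (ω : FullShift κ) :
    iter A n ω * C ω = C (shiftBy n ω) * iter B n ω := by
  rcases n with n | n
  · exact h.iterNat n ω
  · have key := h.iterNat (n + 1) (shiftBy (Int.negSucc n) ω)
    rw [shiftBy_shiftBy, show ((n + 1 : ℕ) : ℤ) + Int.negSucc n = 0 by omega,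
      shiftBy_zero] at key
    simp only [LinCocycle.iter]
    rw [inv_mul_eq_iff_eq_mul, ← mul_assoc, key, mul_inv_cancel_right]

variable (h : IsTransfer C A B) {K : Set (Matrix.SpecialLinearGroup (Fin d) ℝ)} (hK : IsCompact K)
  {ω : FullShift κ} (hCK : ∀ n : ℤ, C (shiftBy n ω) ∈ K)

include h hK hCK

theorem hasExponent_iff (v : EuclideanSpace ℝ (Fin d)) {l : Filter ℤ} (hl : l ≤ cofinite) {a : ℝ} :
    HasExponent (fun n => slAct (LinCocycle.iter A n ω) (slAct (C ω) v)) l a ↔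
      HasExponent (fun n => slAct (LinCocycle.iter B n ω) v) l a := by
  simp only [← slAct_mul, h.iter]
  simp only [slAct_mul]
  exact hasExponent_congr hl (isTheta_slAct_of_isCompact hK hCK _)

theorem lyapunovSpectrum_eq : lyapunovSpectrum A ω = lyapunovSpectrum B ω := by
  ext a
  constructor
  · rintro ⟨v, hv, hva⟩
    refine ⟨slAct (C ω)⁻¹ v, slAct_ne_zero _ hv,
      (h.hasExponent_iff hK hCK _ atTop_le_cofinite).mp ?_⟩
    simp only [slAct_slAct_inv]
    exact hva
  · rintro ⟨v, hv, hva⟩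
    exact ⟨slAct (C ω) v, slAct_ne_zero _ hv,
      (h.hasExponent_iff hK hCK v atTop_le_cofinite).mpr hva⟩

end IsTransfer

end Transfer

theorem IsTransfer.lyapunovSpectrum_eq_of_mem_periodicPts {A B C : LinCocycle κ d}
    (h : IsTransfer C A B) {p : FullShift κ} (hp : p ∈ Function.periodicPts shift) :
    lyapunovSpectrum A p = lyapunovSpectrum B p := by
  obtain ⟨N, hN, hpN⟩ := hp
  exact h.lyapunovSpectrum_eq ((finite_range_shiftBy hN hpN).image C).isCompact
    fun n => ⟨_, ⟨n, rfl⟩, rfl⟩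

/-- All values of `D` are diagonal matrices. -/
def IsDiagonal (D : LinCocycle κ d) : Prop :=
  ∀ ω, (D ω).1.IsDiag

/-- The logarithmic rate at which a diagonal cocycle expands the `i`-th coordinate axis. -/
noncomputable def logEntry (D : LinCocycle κ d) (i : Fin d) (ω : FullShift κ) : ℝ :=
  Real.log |D ω i i|

namespace IsDiagonal

variable {D : LinCocycle κ d} (hD : D.IsDiagonal)

include hD

theorem iterNat (n : ℕ) (ω : FullShift κ) : (iterNat D n ω).1.IsDiag := by
  induction n with
  | zero => exact Matrix.isDiag_one
  | succ n ih => exact isDiag_mul (hD _) ih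

theorem iter (n : ℤ) (ω : FullShift κ) : (iter D n ω).1.IsDiag := by
  rcases n with n | n
  · exact hD.iterNat n ω
  · exact isDiag_slInv (hD.iterNat _ _)

theorem log_abs_iterNat_entry (n : ℕ) (ω : FullShift κ) (i : Fin d) :
    Real.log |LinCocycle.iterNat D n ω i i| = birkhoffSum shift (logEntry D i) n ω := by
  induction n with
  | zero => simp [iterNat_zero]
  | succ n ih =>
    rw [iterNat_succ, slEntry_mul_of_isDiag_left (hD _), abs_mul, Real.log_mul
      (abs_ne_zero.mpr (slEntry_ne_zero_of_isDiag (hD _) i))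
      (abs_ne_zero.mpr (slEntry_ne_zero_of_isDiag (hD.iterNat _ _) i)), ih, birkhoffSum_succ,
      shift_iterate, add_comm, logEntry]

theorem continuous_logEntry (hcont : Continuous D) (i : Fin d) : Continuous (logEntry D i) :=
  (((continuous_slEntry i i).comp hcont).abs).log fun ω =>
    abs_ne_zero.mpr (slEntry_ne_zero_of_isDiag (hD ω) i)

theorem hasExponent_slAct_single_iff {ω : FullShift κ} {i : Fin d} {t : ℝ} (ht : t ≠ 0) {a : ℝ} :
    HasExponent (fun n => slAct (LinCocycle.iter D n ω) (EuclideanSpace.single i t)) atTop a ↔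
      Tendsto (birkhoffAverage ℝ shift (logEntry D i) · ω) atTop (𝓝 a) := by
  rw [_root_.hasExponent_slAct_single_iff atTop_le_cofinite (hD.iter · ω) i ht,
    hasExponent_atTop_iff]
  simp only [birkhoffAverage, smul_eq_mul, ← hD.log_abs_iterNat_entry, Real.norm_eq_abs]
  rfl

theorem lyapunovSpectrum_eq_range {ω : FullShift κ} {a : Fin d → ℝ} (ha : Function.Injective a)
    (h : ∀ i, Tendsto (birkhoffAverage ℝ shift (logEntry D i) · ω) atTop (𝓝 (a i))) :
    lyapunovSpectrum D ω = Set.range a := by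
  have hexp : ∀ i {t : ℝ}, t ≠ 0 → HasExponent
      (fun n => slAct (LinCocycle.iter D n ω) (EuclideanSpace.single i t)) atTop (a i) :=
    fun i _ ht => (hD.hasExponent_slAct_single_iff ht).mpr (h i)
  ext b
  constructor
  · rintro ⟨v, hv, hvb⟩
    have hsum : ∑ i, EuclideanSpace.single i (v i) = v := by
      ext j; simp [Finset.sum_apply, Pi.single_apply]
    obtain ⟨i, hi⟩ := exists_hasExponent_slAct_sum (M := (LinCocycle.iter D · ω)) ha
      (v := fun i => EuclideanSpace.single i (v i)) (hsum.symm ▸ hv)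
      fun i hi => hexp i (by simpa using hi)
    rw [hsum] at hi
    exact ⟨i, tendsto_nhds_unique hi hvb⟩
  · rintro ⟨i, rfl⟩
    exact ⟨EuclideanSpace.single i 1, by simp, hexp i one_ne_zero⟩

end IsDiagonal

end LinCocycle

theorem exists_continuous_section {X 𝕜 V : Type*} [TopologicalSpace X] [CompactSpace X] [T2Space X]
    [TotallyDisconnectedSpace X] [RCLike 𝕜] [NormedAddCommGroup V] [InnerProductSpace 𝕜 V]
    {F : X → Submodule 𝕜 V} [∀ x, (F x).HasOrthogonalProjection] (hF : ∀ x, F x ≠ ⊥)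
    (hcont : Continuous fun x => (F x).starProjection) :
    ∃ v : X → V, Continuous v ∧ ∀ x, v x ∈ F x ∧ v x ≠ 0 := by
  choose u huF hu0 using fun x => Submodule.exists_mem_ne_zero_of_ne_bot (hF x)
  obtain ⟨n, g, c, hg, hgc⟩ := ContinuousMap.exists_finite_approximation_of_mem_nhds_diagonal
    ⟨_, hcont⟩ (Metric.dist_mem_uniformity one_half_pos |> nhdsSet_diagonal_le_uniformity)
  choose r hr using fun y : Set.range g => y.2
  let ρ : X → X := fun x => r ⟨g x, x, rfl⟩
  have hρ : Continuous (u ∘ ρ) :=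
    (continuous_of_discreteTopology (f := u ∘ r)).comp (hg.subtype_mk fun x => ⟨x, rfl⟩)
  refine ⟨fun x => (F x).starProjection (u (ρ x)), hcont.clm_apply hρ, fun x =>
    ⟨Submodule.starProjection_apply_mem _ _, fun (h0 : (F x).starProjection (u (ρ x)) = 0) => ?_⟩⟩
  have hclose : ‖(F (ρ x)).starProjection - (F x).starProjection‖ < 1 := by
    have h1 := hgc (ρ x)
    rw [hr ⟨g x, x, rfl⟩] at h1
    rw [← dist_eq_norm, ← add_halves (1 : ℝ)]
    exact (dist_triangle_right _ _ _).trans_lt (add_lt_add h1 (hgc x))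
  have hle := ((F (ρ x)).starProjection - (F x).starProjection).le_opNorm (u (ρ x))
  rw [sub_apply, h0, sub_zero, Submodule.starProjection_eq_self_iff.mpr (huF _)] at hle
  exact hle.not_gt (mul_lt_of_lt_one_left (norm_pos_iff.mpr (hu0 _)) hclose)

theorem det_ne_zero_of_isInternal {d : ℕ} {E : Fin d → Submodule ℝ (EuclideanSpace ℝ (Fin d))}
    (hE : DirectSum.IsInternal E) {v : Fin d → EuclideanSpace ℝ (Fin d)} (hv : ∀ i, v i ∈ E i)
    (hv0 : ∀ i, v i ≠ 0) : (Matrix.of fun r i => v i r).det ≠ 0 := by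
  have hli := (hE.submodule_iSupIndep.linearIndependent E hv hv0).map'
    (WithLp.linearEquiv 2 ℝ (Fin d → ℝ)).toLinearMap (LinearEquiv.ker _)
  have hunit : IsUnit (Matrix.of fun r i => v i r) :=
    Matrix.linearIndependent_cols_iff_isUnit.mp hli
  exact ((Matrix.isUnit_iff_isUnit_det _).mp hunit).ne_zero

theorem isDiag_inv_mul_mul_of_mapsTo_lines {d : ℕ}
    {F : Fin d → Submodule ℝ (EuclideanSpace ℝ (Fin d))} (hF : ∀ i, Module.finrank ℝ (F i) = 1)
    {M B C : Matrix.SpecialLinearGroup (Fin d) ℝ}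
    (hC : ∀ i, slAct C (EuclideanSpace.single i 1) ∈ F i)
    (hMB : ∀ i, slAct M (slAct B (EuclideanSpace.single i 1)) ∈ F i) :
    (C⁻¹ * M * B).1.IsDiag := fun j i hji => by
  have hC0 : (⟨_, hC i⟩ : F i) ≠ 0 := fun h =>
    slAct_ne_zero C (v := EuclideanSpace.single i 1) (by simp) (congrArg Subtype.val h)
  obtain ⟨t, ht⟩ := (finrank_eq_one_iff_of_nonzero' _ hC0).mp (hF i) ⟨_, hMB i⟩
  have ht' : t • slAct C (EuclideanSpace.single i 1) =
    slAct M (slAct B (EuclideanSpace.single i 1)) := congrArg Subtype.val ht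
  have hentry := slAct_single (C⁻¹ * M * B) i j
  rw [slAct_mul, slAct_mul, ← ht', map_smul, slAct_inv_slAct] at hentry
  simpa [hji] using hentry.symm

namespace LinCocycle

variable {κ d : ℕ}

/-- The frame `C` is adapted to the splitting `E`: the `i`-th column of `C ω` lies on the `i`-th
line at `ω`. -/
def IsAdaptedFrame (C : LinCocycle κ d)
    (E : Fin d → FullShift κ → Submodule ℝ (EuclideanSpace ℝ (Fin d))) : Prop :=
  ∀ ω i, slAct (C ω) (EuclideanSpace.single i 1) ∈ E i ω

/-- `D` is the diagonal form of the cocycle `A` in the continuous frame `C`. -/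
structure IsDiagonalFrame (A C D : LinCocycle κ d) : Prop where
  continuous_frame : Continuous C
  continuous_diag : Continuous D
  isTransfer : IsTransfer C A D
  isDiagonal : IsDiagonal D

/-- The `i`-th diagonal entry of `D` dominates the `j`-th one: the `j`-th entry of the `n`-th
iterate is negligible against the `i`-th one as `n → ∞`, uniformly in the base point. -/
def EntryDominates (D : LinCocycle κ d) (i j : Fin d) : Prop :=
  (fun x : ℕ × FullShift κ => iterNat D x.1 x.2 j j) =o[atTop ×ˢ ⊤]
    fun x => iterNat D x.1 x.2 i i

theorem EntryDominates.isLittleO {D : LinCocycle κ d} {i j : Fin d} (h : D.EntryDominates i j)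
    {ι : Type*} {l : Filter ι} {n : ι → ℕ} (hn : Tendsto n l atTop) (ω : ι → FullShift κ) :
    (fun k => iterNat D (n k) (ω k) j j) =o[l] fun k => iterNat D (n k) (ω k) i i :=
  h.comp_tendsto (hn.prodMk (tendsto_top (f := ω)))

theorem Dominates.isLittleO {A : LinCocycle κ d}
    {E F : FullShift κ → Submodule ℝ (EuclideanSpace ℝ (Fin d))} (h : Dominates A E F)
    {v w : FullShift κ → EuclideanSpace ℝ (Fin d)} (hv : ∀ ω, v ω ∈ E ω) (hw : ∀ ω, w ω ∈ F ω) :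
    (fun x : ℕ × FullShift κ => ‖slAct (iterNat A x.1 x.2) (w x.2)‖ * ‖v x.2‖) =o[atTop ×ˢ ⊤]
      fun x => ‖slAct (iterNat A x.1 x.2) (v x.2)‖ * ‖w x.2‖ := by
  obtain ⟨c, θ, -, hθ, hθ1, hle⟩ := h
  have hpow : (fun x : ℕ × FullShift κ => c * θ ^ x.1) =o[atTop ×ˢ ⊤] fun _ => (1 : ℝ) :=
    ((Asymptotics.isLittleO_one_iff ℝ).mpr
      ((tendsto_pow_atTop_nhds_zero_of_lt_one hθ.le hθ1).comp tendsto_fst)).const_mul_left c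
  have hscaled := (hpow.mul_isBigO (Asymptotics.isBigO_refl
    (fun x : ℕ × FullShift κ => ‖slAct (iterNat A x.1 x.2) (v x.2)‖ * ‖w x.2‖) _)).congr_right
    fun x => one_mul _
  refine Asymptotics.IsBigO.trans_isLittleO (.of_norm_eventuallyLE ?_) hscaled
  filter_upwards [(eventually_ge_atTop 1).prod_inl ⊤] with x hx
  rw [Real.norm_of_nonneg (by positivity)]
  exact hle x.1 hx x.2 _ (hv x.2) _ (hw x.2)

section AdaptedFrame

variable {A C D : LinCocycle κ d}
  {E : Fin d → FullShift κ → Submodule ℝ (EuclideanSpace ℝ (Fin d))}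

theorem exists_continuous_isAdaptedFrame [NeZero d] (hrank : ∀ i ω, Module.finrank ℝ (E i ω) = 1)
    (hsplit : ∀ ω, DirectSum.IsInternal fun i => E i ω)
    (hcont : ∀ i, Continuous fun ω => (E i ω).starProjection) :
    ∃ C : LinCocycle κ d, Continuous C ∧ IsAdaptedFrame C E := by
  have hbot : ∀ i ω, E i ω ≠ ⊥ := fun i ω h => by
    have hzero := hrank i ω
    rw [h, finrank_bot] at hzero
    exact zero_ne_one hzero
  choose v hvc hv using fun i => exists_continuous_section (hbot i) (hcont i)
  let F : FullShift κ → Matrix (Fin d) (Fin d) ℝ := fun ω => Matrix.of fun r i => v i ω r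
  have hF : Continuous F := continuous_matrix fun r i =>
    (EuclideanSpace.proj (𝕜 := ℝ) r).continuous.comp (hvc i)
  have hdet : ∀ ω, (F ω).det ≠ 0 := fun ω =>
    det_ne_zero_of_isInternal (hsplit ω) (fun i => (hv i ω).1) fun i => (hv i ω).2
  let s : FullShift κ → Fin d → ℝ := fun ω i => if i = 0 then (F ω).det⁻¹ else 1
  have hs : ∀ i, Continuous fun ω => s ω i := fun i => by
    by_cases hi : i = 0
    · simp only [s, hi, if_true]
      exact hF.matrix_det.inv₀ hdet
    · simpa only [s, hi, if_false] using continuous_const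
  have hdet_one : ∀ ω, (Matrix.of fun r i => s ω i * F ω r i).det = 1 := fun ω => by
    rw [Matrix.det_mul_row, Finset.prod_ite_eq', if_pos (Finset.mem_univ _),
      inv_mul_cancel₀ (hdet ω)]
  refine ⟨fun ω => ⟨_, hdet_one ω⟩, Continuous.subtype_mk
    (continuous_matrix fun r i => (hs i).mul (hF.matrix_elem r i)) hdet_one, fun ω i => ?_⟩
  convert (E i ω).smul_mem (s ω i) (hv i ω).1 using 1
  ext r
  exact slAct_single _ i r

theorem isDiagonalFrame_of_isAdaptedFrame (hA : Continuous A) (hC : Continuous C)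
    (hCE : IsAdaptedFrame C E) (hrank : ∀ i ω, Module.finrank ℝ (E i ω) = 1)
    (hinv : ∀ i ω, (E i ω).map (slAct (A ω)) = E i (shift ω)) :
    IsDiagonalFrame A C fun ω => (C (shift ω))⁻¹ * A ω * C ω where
  continuous_frame := hC
  continuous_diag := ((hC.comp continuous_shift).inv.mul hA).mul hC
  isTransfer ω := by group
  isDiagonal ω := isDiag_inv_mul_mul_of_mapsTo_lines (fun i => hrank i (shift ω)) (hCE (shift ω))
    fun i => hinv i ω ▸ Submodule.mem_map_of_mem (hCE ω i)

theorem IsDiagonalFrame.isTheta_slAct_iterNat_column (h : IsDiagonalFrame A C D) (i : Fin d)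
    (l : Filter (ℕ × FullShift κ)) :
    (fun x : ℕ × FullShift κ =>
      slAct (iterNat A x.1 x.2) (slAct (C x.2) (EuclideanSpace.single i 1))) =Θ[l]
    fun x => iterNat D x.1 x.2 i i := by
  simp only [← slAct_mul, h.isTransfer.iterNat]
  simp only [slAct_mul, slAct_single_of_isDiag (h.isDiagonal.iterNat _ _)]
  refine (isTheta_slAct_of_isCompact (isCompact_range h.continuous_frame)
    (fun x => ⟨_, rfl⟩) _).trans (.of_norm_eventuallyEq_norm (Eventually.of_forall fun x => ?_))
  simp only [norm_smul, PiLp.norm_single, norm_one, mul_one]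

theorem IsDiagonalFrame.entryDominates_of_dominates (h : IsDiagonalFrame A C D)
    (hCE : IsAdaptedFrame C E) {i j : Fin d} (hdom : Dominates A (E i) (E j)) :
    D.EntryDominates i j := by
  have hunit (k : Fin d) : (fun _ : ℕ × FullShift κ =>
      (EuclideanSpace.single k 1 : EuclideanSpace ℝ (Fin d))) =Θ[atTop ×ˢ ⊤] fun _ => (1 : ℝ) :=
    Asymptotics.isTheta_const_const (by simp) one_ne_zero
  have hcolumn (k : Fin d) : (fun x : ℕ × FullShift κ =>
      slAct (C x.2) (EuclideanSpace.single k 1)) =Θ[atTop ×ˢ ⊤] fun _ => (1 : ℝ) :=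
    (isTheta_slAct_of_isCompact (M := fun x : ℕ × FullShift κ => C x.2)
      (isCompact_range h.continuous_frame) (fun x => ⟨x.2, rfl⟩) _).trans (hunit k)
  have hentry (k m : Fin d) : (fun x : ℕ × FullShift κ =>
      ‖slAct (iterNat A x.1 x.2) (slAct (C x.2) (EuclideanSpace.single k 1))‖ *
        ‖slAct (C x.2) (EuclideanSpace.single m 1)‖) =Θ[atTop ×ˢ ⊤]
      fun x => iterNat D x.1 x.2 k k * 1 :=
    (h.isTheta_slAct_iterNat_column k _).norm_left.mul (hcolumn m).norm_left
  simp only [mul_one] at hentry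
  exact (hentry j i).isBigO_symm.trans_isLittleO
    ((hdom.isLittleO (v := fun ω => slAct (C ω) (EuclideanSpace.single i 1))
      (w := fun ω => slAct (C ω) (EuclideanSpace.single j 1)) (hCE · i) (hCE · j)).trans_isBigO
      (hentry i j).isBigO)

theorem IsFinestDominatedSplitting.entryDominates (hE : IsFinestDominatedSplitting A E)
    (h : IsDiagonalFrame A C D) (hCE : IsAdaptedFrame C E) {i j : Fin d} (hij : i < j) :
    D.EntryDominates i j := by
  obtain _ | d := d
  · exact i.elim0
  have : IsTrans (Fin (d + 1)) D.EntryDominates := ⟨fun _ _ _ hij hjk => hjk.trans hij⟩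
  exact (Fin.liftFun_iff_succ D.EntryDominates (f := id)).mpr
    (fun k => h.entryDominates_of_dominates hCE (hE.dominated _ _ rfl)) hij

theorem IsFinestDominatedSplitting.exists_isDiagonalFrame [NeZero d]
    (hE : IsFinestDominatedSplitting A E) (hA : Continuous A) :
    ∃ C D : LinCocycle κ d, IsDiagonalFrame A C D ∧ IsAdaptedFrame C E ∧
      ∀ i j, i < j → D.EntryDominates i j := by
  obtain ⟨C, hC, hCE⟩ := exists_continuous_isAdaptedFrame hE.one_dim hE.splits hE.continuous
  have h := isDiagonalFrame_of_isAdaptedFrame hA hC hCE hE.one_dim hE.invariant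
  exact ⟨C, _, h, hCE, fun _ _ => hE.entryDominates h hCE⟩

end AdaptedFrame

end LinCocycle

section DominatingEntry

variable {d : ℕ} {M N : Matrix.SpecialLinearGroup (Fin d) ℝ} {i : Fin d}

theorem slEntry_mul_of_row (hM : ∀ k ≠ i, M i k = 0) (j : Fin d) :
    (M * N) i j = M i i * N i j := by
  rw [Matrix.SpecialLinearGroup.coe_mul, Matrix.mul_apply]
  exact Finset.sum_eq_single i (fun k _ hk => by rw [hM k hk, zero_mul]) (by simp)

theorem slEntry_mul_of_col (hN : ∀ k ≠ i, N k i = 0) (j : Fin d) :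
    (M * N) j i = M j i * N i i := by
  rw [Matrix.SpecialLinearGroup.coe_mul, Matrix.mul_apply]
  exact Finset.sum_eq_single i (fun k _ hk => by rw [hN k hk, mul_zero]) (by simp)

theorem slEntry_ne_zero_of_row (hM : ∀ k ≠ i, M i k = 0) : M i i ≠ 0 := fun h => by
  have hone := slEntry_mul_of_row (N := M⁻¹) hM i
  simp [h] at hone

theorem slEntry_ne_zero_of_col (hN : ∀ k ≠ i, N k i = 0) : N i i ≠ 0 := fun h => by
  have hone := slEntry_mul_of_col (M := N⁻¹) hN i
  simp [h] at hone

theorem slEntry_eq_zero_of_mul_eq_mul {ι : Type*} {l : Filter ι} [l.NeBot]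
    {K : Set (Matrix.SpecialLinearGroup (Fin d) ℝ)} (hK : IsCompact K)
    {Q X Y : ι → Matrix.SpecialLinearGroup (Fin d) ℝ} {P : Matrix.SpecialLinearGroup (Fin d) ℝ}
    (hQ : ∀ n, Q n ∈ K) (hX : ∀ n, (X n).1.IsDiag) (hY : ∀ n, (Y n).1.IsDiag)
    (hQX : ∀ n, Q n * X n = Y n * P)
    (hXdom : ∀ j ≠ i, (fun n => X n j j) =o[l] fun n => X n i i)
    (hYdom : ∀ j ≠ i, (fun n => Y n j j) =o[l] fun n => Y n i i) {j : Fin d} (hj : j ≠ i) :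
    P i j = 0 := by
  -- `P i j` is the `(i, j)` entry of `(Y n)⁻¹ * Q n * X n`, and `X n j j ≪ X n i i ≲ Y n i i`.
  have hYle (k : Fin d) : (fun n => Y n k k) =O[l] fun n => Y n i i := by
    rcases eq_or_ne k i with rfl | hk
    exacts [Asymptotics.isBigO_refl _ _, (hYdom k hk).isBigO]
  have hXY : (fun n => X n i i) =O[l] fun n => Y n i i := by
    have hsum : ∀ n, X n i i = ∑ k, (Q n)⁻¹ i k * (Y n k k * P k i) := fun n => by
      simp only [← slEntry_mul_of_isDiag_left (hY n), ← hQX]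
      rw [← Matrix.mul_apply, ← Matrix.SpecialLinearGroup.coe_mul, inv_mul_cancel_left]
    simp only [hsum]
    refine Asymptotics.IsBigO.fun_sum fun k _ => ?_
    simpa [mul_comm] using (isBigO_slEntry_of_isCompact hK.inv
      (fun n => Set.inv_mem_inv.mpr (hQ n)) i k).mul ((hYle k).const_mul_left (P k i))
  have hentry : (fun n => Y n i i * P i j) =o[l] fun n => Y n i i := by
    simp only [← slEntry_mul_of_isDiag_left (hY _), ← hQX, slEntry_mul_of_isDiag_right (hX _)]
    simpa using (isBigO_slEntry_of_isCompact hK hQ i j).mul_isLittleO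
      ((hXdom j hj).trans_isBigO hXY)
  by_contra hP
  simp only [mul_comm _ (P i j)] at hentry
  exact Asymptotics.isLittleO_irrefl
    (Eventually.of_forall fun n => slEntry_ne_zero_of_isDiag (hY n) i).frequently
    ((Asymptotics.isLittleO_const_mul_left_iff hP).mp hentry)

end DominatingEntry

namespace LinCocycle

variable {κ d : ℕ} {A C D : LinCocycle κ d}

/-- The matrix that rewrites coordinates in the frame at `ω` as coordinates in the frame at `ω'`. -/
def transition (C : LinCocycle κ d) (ω ω' : FullShift κ) : Matrix.SpecialLinearGroup (Fin d) ℝ :=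
  (C ω')⁻¹ * C ω

theorem transition_self (C : LinCocycle κ d) (ω : FullShift κ) : transition C ω ω = 1 :=
  inv_mul_cancel _

theorem transition_mul_transition (C : LinCocycle κ d) (ω ω' ω'' : FullShift κ) :
    transition C ω' ω'' * transition C ω ω' = transition C ω ω'' := by
  simp only [transition]
  group

theorem continuous_transition (hC : Continuous C) :
    Continuous fun x : FullShift κ × FullShift κ => transition C x.1 x.2 :=
  (hC.comp continuous_snd).inv.mul (hC.comp continuous_fst)

namespace IsDiagonalFrame

variable (h : IsDiagonalFrame A C D)

include h

theorem transition_mul_iterNat {n : ℕ} {ω ω' : FullShift κ}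
    (hn : LinCocycle.iterNat A n ω = LinCocycle.iterNat A n ω') :
    transition C (shiftBy n ω) (shiftBy n ω') * LinCocycle.iterNat D n ω =
      LinCocycle.iterNat D n ω' * transition C ω ω' := by
  have hω := h.isTransfer.iterNat n ω
  have hω' := h.isTransfer.iterNat n ω'
  rw [← hn, ← eq_mul_inv_iff_mul_eq] at hω'
  rw [transition, mul_assoc, ← hω, hω', transition]
  group

variable (hA : A.IsLocConst) {i : Fin d} (hdom : ∀ j ≠ i, D.EntryDominates i j)

include hA hdom

theorem transition_row_eq_zero {ω ω' : FullShift κ} (hfuture : ∀ k ≥ 0, ω k = ω' k) {j : Fin d}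
    (hj : j ≠ i) : transition C ω ω' i j = 0 :=
  slEntry_eq_zero_of_mul_eq_mul (l := atTop)
    (isCompact_range (continuous_transition h.continuous_frame))
    (fun n : ℕ => ⟨(shiftBy n ω, shiftBy n ω'), rfl⟩)
    (fun n => h.isDiagonal.iterNat n ω) (fun n => h.isDiagonal.iterNat n ω')
    (fun n => h.transition_mul_iterNat (hA.iterNat_congr n fun k hk _ => hfuture k hk))
    (fun k hk => (hdom k hk).isLittleO tendsto_id fun _ => ω)
    (fun k hk => (hdom k hk).isLittleO tendsto_id fun _ => ω') hj

theorem transition_col_eq_zero {ω ω' : FullShift κ} (hpast : ∀ k < 0, ω k = ω' k) {j : Fin d}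
    (hj : j ≠ i) : transition C ω ω' j i = 0 := by
  have hmul : ∀ n : ℕ, transition C ω ω' * LinCocycle.iterNat D n (shiftBy (-n) ω) =
      LinCocycle.iterNat D n (shiftBy (-n) ω') *
        transition C (shiftBy (-n) ω) (shiftBy (-n) ω') := fun n => by
    have hn := h.transition_mul_iterNat (ω := shiftBy (-n) ω) (ω' := shiftBy (-n) ω')
      (hA.iterNat_congr n fun k _ hk => hpast _ (by omega))
    simpa only [shiftBy_shiftBy, add_neg_cancel, shiftBy_zero] using hn
  have hcont : Continuous fun x : FullShift κ × FullShift κ => (transition C x.1 x.2).transpose :=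
    (continuous_transition h.continuous_frame).subtype_val.matrix_transpose.subtype_mk _
  exact slEntry_eq_zero_of_mul_eq_mul (l := atTop) (isCompact_range hcont)
    (P := (transition C ω ω').transpose)
    (X := fun n : ℕ => (LinCocycle.iterNat D n (shiftBy (-n) ω')).transpose)
    (Y := fun n : ℕ => (LinCocycle.iterNat D n (shiftBy (-n) ω)).transpose)
    (fun n : ℕ => ⟨(shiftBy (-n) ω, shiftBy (-n) ω'), rfl⟩)
    (fun n => (h.isDiagonal.iterNat n _).transpose) (fun n => (h.isDiagonal.iterNat n _).transpose)
    (fun n => Subtype.ext (by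
      simpa [Matrix.transpose_mul] using congrArg (fun M => M.1.transpose) (hmul n).symm))
    (fun k hk => (hdom k hk).isLittleO tendsto_id _)
    (fun k hk => (hdom k hk).isLittleO tendsto_id _) hj

theorem transition_entry_ne_zero (ω ω' : FullShift κ) : transition C ω ω' i i ≠ 0 := by
  let η := splice 0 ω ω'
  have hrow : ∀ k ≠ i, transition C η ω' i k = 0 := fun k hk =>
    h.transition_row_eq_zero hA hdom (fun j hj => splice_of_le ω ω' hj) hk
  have hcol : ∀ k ≠ i, transition C ω η k i = 0 := fun k hk =>
    h.transition_col_eq_zero hA hdom (fun j hj => (splice_of_lt ω ω' hj).symm) hk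
  rw [← transition_mul_transition C ω η ω', slEntry_mul_of_row hrow]
  exact mul_ne_zero (slEntry_ne_zero_of_row hrow) (slEntry_ne_zero_of_col hcol)

end IsDiagonalFrame

variable {i : Fin d}

theorem tendsto_inv_smul_iterNat (hD : D.IsDiagonal)
    (hdom : ∀ j ≠ i, D.EntryDominates i j) (ω : FullShift κ) :
    Tendsto (fun n => (iterNat D n ω i i)⁻¹ • (iterNat D n ω).1) atTop
      (𝓝 (Matrix.single i i 1)) := by
  refine tendsto_pi_nhds.mpr fun j => tendsto_pi_nhds.mpr fun k => ?_
  simp only [Matrix.smul_apply, smul_eq_mul]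
  rcases eq_or_ne j k with rfl | hjk
  · rcases eq_or_ne j i with rfl | hji
    · simp [inv_mul_cancel₀ (slEntry_ne_zero_of_isDiag (hD.iterNat _ ω) j)]
    · simpa [hji.symm, div_eq_inv_mul] using
        ((hdom j hji).isLittleO tendsto_id fun _ => ω).tendsto_div_nhds_zero
  · have hzero : Matrix.single i i (1 : ℝ) j k = 0 :=
      Matrix.single_apply_of_ne _ _ _ _ _ fun h => hjk (h.1.symm.trans h.2)
    simp [hD.iterNat _ ω hjk, hzero]

theorem IsLocConst.iterNat_periodize (hA : A.IsLocConst) {s : Fin κ} {ω : FullShift κ} {m : ℕ}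
    (hpast : ∀ j < 0, ω j = s) (hfuture : ∀ j ≥ (m : ℤ), ω j = s) (n : ℕ) :
    iterNat A (n + m + n) (periodize (n + m + n) (shiftBy (-n) ω)) =
      iterNat A n (constSeq s) * iterNat A m ω * iterNat A n (constSeq s) := by
  have hword : ∀ j : ℤ, 0 ≤ j → j < (n + m + n : ℕ) →
      periodize (n + m + n) (shiftBy (-n) ω) j = ω (j - n) := fun j => periodize_of_mem _
  rw [iterNat_add, iterNat_add, shiftBy_shiftBy]
  congr 1
  · congr 1
    · refine hA.iterNat_congr n fun j h0 hn => ?_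
      rw [shiftBy_apply, hword _ (by omega) (by omega)]
      exact hfuture _ (by omega)
    · refine hA.iterNat_congr m fun j h0 hm => ?_
      rw [shiftBy_apply, hword _ (by omega) (by omega), add_sub_cancel_right]
  · refine hA.iterNat_congr n fun j h0 hn => ?_
    rw [hword _ h0 (by omega)]
    exact hpast _ (by omega)

/-- Under the character `χ`, the `i`-th diagonal entry of `D` multiplies up to `c ^ N` along every
periodic orbit of period `N`. The character is the absolute value when only moduli of multipliers
are compared, and the identity when signs matter too. -/
def HasPeriodicMultiplier (χ : ℝ →*₀ ℝ) (D : LinCocycle κ d) (i : Fin d) (c : ℝ) : Prop :=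
  ∀ (N : ℕ) (p : FullShift κ), Function.IsPeriodicPt shift N p → χ (iterNat D N p i i) = c ^ N

theorem HasPeriodicMultiplier.map_iterNat_constSeq {χ : ℝ →*₀ ℝ} {c : ℝ}
    (hper : HasPeriodicMultiplier χ D i c) (s : Fin κ) (n : ℕ) :
    χ (iterNat D n (constSeq s) i i) = c ^ n :=
  hper n _ (isPeriodicPt_shift_iff.mpr (shiftBy_constSeq n s))

/-- The `i`-th diagonal entry of `D`, seen through the character `χ`, is cohomologous to the
constant `c` through a continuous non-vanishing function. -/
def IsEntryCohomologous (χ : ℝ →*₀ ℝ) (D : LinCocycle κ d) (i : Fin d) (c : ℝ) : Prop :=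
  ∃ g : FullShift κ → ℝ, Continuous g ∧ (∀ ω, g ω ≠ 0) ∧
    ∀ ω, χ (D ω i i) * χ (g ω) = c * χ (g (shift ω))

theorem map_smul_mul_smul_mul_entry {χ : ℝ →*₀ ℝ} {b c : ℝ} {m n : ℕ} (hb : b ≠ 0)
    (hχb : χ b = c ^ n) {X P Q Y : Matrix.SpecialLinearGroup (Fin d) ℝ}
    (hmul : X * P * X * Q = Q * Y) (hY : Y.1.IsDiag) (hχY : χ (Y i i) = c ^ (n + m + n)) :
    χ ((b⁻¹ • X.1 * P.1 * (b⁻¹ • X.1) * Q.1) i i) = c ^ m * χ (Q i i) := by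
  have hscale : b * b * (b⁻¹ • X.1 * P.1 * (b⁻¹ • X.1) * Q.1) i i = Q i i * Y i i := by
    rw [← slEntry_mul_of_isDiag_right hY, ← hmul]
    simp only [Algebra.smul_mul_assoc, Algebra.mul_smul_comm, Matrix.smul_apply, smul_eq_mul,
      Matrix.SpecialLinearGroup.coe_mul]
    field_simp
  have hχscale := congrArg χ hscale
  rw [map_mul, map_mul, map_mul, hχb, hχY] at hχscale
  have hc : c ^ n ≠ 0 := hχb ▸ (map_ne_zero χ).mpr hb
  refine mul_left_cancel₀ (mul_ne_zero hc hc) (hχscale.trans ?_)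
  ring

theorem continuous_transition_entry (hC : Continuous C) (ω' : FullShift κ) (i j : Fin d) :
    Continuous fun ω => transition C ω ω' i j := by
  have hmul : Continuous fun ω => (C ω')⁻¹ * C ω := continuous_const.mul hC
  exact (continuous_slEntry i j).comp hmul

namespace IsDiagonalFrame

variable (h : IsDiagonalFrame A C D) (hA : A.IsLocConst) (hdom : ∀ j ≠ i, D.EntryDominates i j)
  {χ : ℝ →*₀ ℝ} (hχ : Continuous χ) {c : ℝ} (hper : HasPeriodicMultiplier χ D i c)

include h hA

theorem homoclinic_mul {s : Fin κ} {ω : FullShift κ} {m : ℕ}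
    (hpast : ∀ j < 0, ω j = s) (hfuture : ∀ j ≥ (m : ℤ), ω j = s) (n : ℕ) :
    LinCocycle.iterNat D n (constSeq s) *
        ((C (constSeq s))⁻¹ * LinCocycle.iterNat A m ω * C (constSeq s)) *
        LinCocycle.iterNat D n (constSeq s) *
        transition C (periodize (n + m + n) (shiftBy (-n) ω)) (constSeq s) =
      transition C (periodize (n + m + n) (shiftBy (-n) ω)) (constSeq s) *
        LinCocycle.iterNat D (n + m + n) (periodize (n + m + n) (shiftBy (-n) ω)) := by
  have hz := h.isTransfer.iterNat n (constSeq s)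
  have hq := h.isTransfer.iterNat (n + m + n) (periodize (n + m + n) (shiftBy (-n) ω))
  rw [isPeriodicPt_shift_iff.mp (isPeriodicPt_periodize _ _),
    hA.iterNat_periodize hpast hfuture, ← inv_mul_eq_iff_eq_mul] at hq
  rw [shiftBy_constSeq, ← inv_mul_eq_iff_eq_mul] at hz
  simp only [transition]
  rw [mul_assoc _⁻¹ (C (periodize _ _)), ← inv_mul_eq_iff_eq_mul.mp hq, ← hz]
  group

include hdom hχ hper

theorem map_homoclinic_entry {s : Fin κ} {ω : FullShift κ} {m : ℕ}
    (hpast : ∀ j < 0, ω j = s) (hfuture : ∀ j ≥ (m : ℤ), ω j = s) :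
    χ (((C (constSeq s))⁻¹ * LinCocycle.iterNat A m ω * C (constSeq s)) i i) = c ^ m := by
  -- The orbit of `q n` closes up the homoclinic orbit of `ω`; up to scale, its multiplier is read
  -- off `E n * P * E n`, where `E n` tends to the projection onto the `i`-th axis.
  set P := (C (constSeq s))⁻¹ * LinCocycle.iterNat A m ω * C (constSeq s)
  let q : ℕ → FullShift κ := fun n => periodize (n + m + n) (shiftBy (-n) ω)
  let E : ℕ → Matrix (Fin d) (Fin d) ℝ := fun n =>
    (LinCocycle.iterNat D n (constSeq s) i i)⁻¹ • (LinCocycle.iterNat D n (constSeq s)).1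
  have hQ : Tendsto (fun n => transition C (q n) (constSeq s)) atTop (𝓝 1) := by
    have hlim := ((continuous_transition h.continuous_frame).tendsto (constSeq s, constSeq s)).comp
      ((tendsto_periodize_constSeq hpast hfuture).prodMk_nhds tendsto_const_nhds)
    rwa [transition_self] at hlim
  have hE : Tendsto E atTop (𝓝 (Matrix.single i i 1)) :=
    tendsto_inv_smul_iterNat h.isDiagonal hdom (constSeq s)
  have hlim : Tendsto (fun n => (E n * P.1 * E n * (transition C (q n) (constSeq s)).1) i i) atTop
      (𝓝 (P i i)) := by
    have hentry := (continuous_apply_apply i i).tendsto _ |>.comp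
      (((hE.mul_const P.1).mul hE).mul ((continuous_subtype_val.tendsto _).comp hQ))
    have hsingle : (Matrix.single i i (1 : ℝ) * P.1 * Matrix.single i i (1 : ℝ) *
        (1 : Matrix.SpecialLinearGroup (Fin d) ℝ).1) i i = P i i := by
      simp
    rwa [hsingle] at hentry
  have hχE : ∀ n, χ ((E n * P.1 * E n * (transition C (q n) (constSeq s)).1) i i) =
      c ^ m * χ (transition C (q n) (constSeq s) i i) := fun n =>
    map_smul_mul_smul_mul_entry (slEntry_ne_zero_of_isDiag (h.isDiagonal.iterNat n _) i)
      (hper.map_iterNat_constSeq s n)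
      (h.homoclinic_mul hA hpast hfuture n) (h.isDiagonal.iterNat _ _)
      (hper _ _ (isPeriodicPt_periodize _ _))
  have hχQ : Tendsto (fun n => c ^ m * χ (transition C (q n) (constSeq s) i i)) atTop
      (𝓝 (c ^ m)) := by
    have hone := (((hχ.comp (continuous_slEntry i i)).tendsto 1).comp hQ).const_mul (c ^ m)
    rw [Function.comp_apply, Matrix.SpecialLinearGroup.coe_one, Matrix.one_apply_eq, map_one,
      mul_one] at hone
    exact hone
  exact tendsto_nhds_unique ((hχ.tendsto _).comp hlim) (hχQ.congr fun n => (hχE n).symm)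

theorem map_transition_entry_mul {s : Fin κ} {ω : FullShift κ} (hpast : ∀ j < 0, ω j = s) (n : ℕ) :
    χ (transition C (shiftBy n ω) (constSeq s) i i) * χ (LinCocycle.iterNat D n ω i i) =
      c ^ n * χ (transition C ω (constSeq s) i i) := by
  have hword : LinCocycle.iterNat A n ω = LinCocycle.iterNat A n (splice n ω (constSeq s)) :=
    hA.iterNat_congr n fun j _ hj => (splice_of_lt ω _ hj).symm
  have hmul : transition C (shiftBy n ω) (constSeq s) * LinCocycle.iterNat D n ω =
      (C (constSeq s))⁻¹ * LinCocycle.iterNat A n ω * C (constSeq s) *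
        transition C ω (constSeq s) := by
    rw [transition, mul_assoc, ← h.isTransfer.iterNat, transition]
    group
  have hcol : ∀ k ≠ i, transition C ω (constSeq s) k i = 0 := fun k hk =>
    h.transition_col_eq_zero hA hdom hpast hk
  rw [← map_mul, ← slEntry_mul_of_isDiag_right (h.isDiagonal.iterNat n ω), hmul,
    slEntry_mul_of_col hcol, map_mul, hword,
    h.map_homoclinic_entry hA hdom hχ hper
      (fun j hj => (splice_of_lt ω _ (by omega)).trans (hpast j hj))
      fun j hj => splice_of_le _ _ hj]

theorem map_transition_shift_entry_mul (s : Fin κ) (ω : FullShift κ) :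
    χ (transition C (shift ω) (constSeq s) i i) * χ (D ω i i) =
      c * χ (transition C ω (constSeq s) i i) := by
  have hcont : Continuous fun ω => χ (transition C ω (constSeq s) i i) :=
    hχ.comp (continuous_transition_entry h.continuous_frame (constSeq s) i i)
  have hleft : Continuous fun ω => χ (transition C (shift ω) (constSeq s) i i) * χ (D ω i i) :=
    (hcont.comp continuous_shift).mul (hχ.comp ((continuous_slEntry i i).comp h.continuous_diag))
  refine congrFun (Continuous.ext_on (dense_setOf_eventually_past_eq (constSeq s)) hleft
    (hcont.const_mul c) ?_) ω
  rintro ω ⟨m, hm⟩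
  have hpast : ∀ j < 0, shiftBy (-m) ω j = s := fun j hj => hm _ (by omega)
  have hω := h.map_transition_entry_mul hA hdom hχ hper hpast m
  have hshift := h.map_transition_entry_mul hA hdom hχ hper hpast (m + 1)
  rw [shiftBy_shiftBy, add_neg_cancel, shiftBy_zero] at hω
  rw [iterNat_succ, slEntry_mul_of_isDiag_left (h.isDiagonal _), shiftBy_shiftBy, shiftBy_shiftBy,
    add_neg_cancel, shiftBy_zero, Nat.cast_succ, add_neg_cancel_comm, map_mul] at hshift
  have hentry : χ (LinCocycle.iterNat D m (shiftBy (-m) ω) i i) ≠ 0 :=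
    (map_ne_zero χ).mpr (slEntry_ne_zero_of_isDiag (h.isDiagonal.iterNat m _) i)
  refine mul_right_cancel₀ hentry (((mul_assoc _ _ _).trans hshift).trans ?_)
  rw [pow_succ', mul_assoc, ← hω, mul_assoc]

theorem isEntryCohomologous_of_dominating [NeZero κ] : IsEntryCohomologous χ D i c := by
  refine ⟨fun ω => (transition C ω (constSeq 0) i i)⁻¹, ?_, fun ω =>
    inv_ne_zero (h.transition_entry_ne_zero hA hdom ω (constSeq 0)), fun ω => ?_⟩
  · exact (continuous_transition_entry h.continuous_frame (constSeq 0) i i).inv₀ fun ω =>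
      h.transition_entry_ne_zero hA hdom ω (constSeq 0)
  · have hne (ω : FullShift κ) : χ (transition C ω (constSeq 0) i i) ≠ 0 :=
      (map_ne_zero χ).mpr (h.transition_entry_ne_zero hA hdom ω (constSeq 0))
    rw [map_inv₀, map_inv₀, ← div_eq_mul_inv, ← div_eq_mul_inv, div_eq_div_iff (hne ω) (hne _),
      mul_comm (χ (D ω i i))]
    exact h.map_transition_shift_entry_mul hA hdom hχ hper 0 ω

end IsDiagonalFrame

end LinCocycle

theorem eq_of_prod_eq_of_forall_ne {ι M₀ : Type*} [Fintype ι] [CommGroupWithZero M₀]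
    {f g : ι → M₀} {k : ι} (hprod : ∏ i, f i = ∏ i, g i)
    (hg : ∏ i, g i ≠ 0) (h : ∀ i ≠ k, f i = g i) : f k = g k := by
  classical
  rw [← Finset.mul_prod_erase _ f (Finset.mem_univ k),
    ← Finset.mul_prod_erase _ g (Finset.mem_univ k),
    Finset.prod_congr rfl fun i hi => h i (Finset.ne_of_mem_erase hi)] at hprod
  exact mul_right_cancel₀ (Finset.prod_ne_zero_iff.mpr fun i _ =>
    Finset.prod_ne_zero_iff.mp hg i (Finset.mem_univ i)) hprod

section Contragredient

variable {d : ℕ}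

/-- The contragredient `M ↦ (M⁻¹)ᵀ` of the standard representation. It reverses the domination
order of a diagonal cocycle, so that a dominated line becomes a dominating one. -/
def contragredient :
    Matrix.SpecialLinearGroup (Fin d) ℝ →* Matrix.SpecialLinearGroup (Fin d) ℝ where
  toFun M := M⁻¹.transpose
  map_one' := Subtype.ext (by simp)
  map_mul' M N := Subtype.ext (by
    rw [mul_inv_rev, Matrix.SpecialLinearGroup.coe_transpose, Matrix.SpecialLinearGroup.coe_mul,
      Matrix.transpose_mul]
    rfl)

theorem continuous_contragredient :
    Continuous (contragredient : Matrix.SpecialLinearGroup (Fin d) ℝ →* _) := by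
  have hinv : Continuous fun M : Matrix.SpecialLinearGroup (Fin d) ℝ => M⁻¹.1 :=
    continuous_subtype_val.comp continuous_inv
  exact hinv.matrix_transpose.subtype_mk _

variable {D : Matrix.SpecialLinearGroup (Fin d) ℝ} (hD : D.1.IsDiag)

include hD

theorem isDiag_contragredient : (contragredient D).1.IsDiag :=
  (isDiag_slInv hD).transpose

theorem contragredient_entry_of_isDiag (i : Fin d) : contragredient D i i = (D i i)⁻¹ :=
  slEntry_inv_of_isDiag hD i

end Contragredient

namespace LinCocycle

variable {κ d : ℕ} {A C D : LinCocycle κ d} {i j : Fin d}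

/-- The cocycle induced by `A` on the dual space, in the dual of the standard basis. -/
def dual (A : LinCocycle κ d) : LinCocycle κ d :=
  fun ω => contragredient (A ω)

theorem iterNat_dual (A : LinCocycle κ d) (n : ℕ) (ω : FullShift κ) :
    iterNat (dual A) n ω = contragredient (iterNat A n ω) := by
  induction n with
  | zero => exact (map_one contragredient).symm
  | succ n ih => rw [iterNat_succ, iterNat_succ, map_mul, ih, dual]

theorem IsLocConst.dual (hA : A.IsLocConst) : A.dual.IsLocConst :=
  fun ω ω' h => congrArg contragredient (hA ω ω' h)

theorem IsDiagonalFrame.dual (h : IsDiagonalFrame A C D) :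
    IsDiagonalFrame A.dual C.dual D.dual where
  continuous_frame := continuous_contragredient.comp h.continuous_frame
  continuous_diag := continuous_contragredient.comp h.continuous_diag
  isTransfer ω := by simp only [LinCocycle.dual, ← map_mul, h.isTransfer ω]
  isDiagonal ω := isDiag_contragredient (h.isDiagonal ω)

theorem IsDiagonal.iterNat_dual_entry (hD : D.IsDiagonal) (n : ℕ) (ω : FullShift κ) (i : Fin d) :
    LinCocycle.iterNat D.dual n ω i i = (LinCocycle.iterNat D n ω i i)⁻¹ := by
  rw [iterNat_dual, contragredient_entry_of_isDiag (hD.iterNat n ω)]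

theorem EntryDominates.dual (h : D.EntryDominates i j) (hD : D.IsDiagonal) :
    D.dual.EntryDominates j i := by
  simp only [EntryDominates, hD.iterNat_dual_entry]
  exact h.inv_rev (Eventually.of_forall fun x hx =>
    absurd hx (slEntry_ne_zero_of_isDiag (hD.iterNat x.1 x.2) j))

theorem HasPeriodicMultiplier.dual {χ : ℝ →*₀ ℝ} {c : ℝ} (h : HasPeriodicMultiplier χ D i c)
    (hD : D.IsDiagonal) : HasPeriodicMultiplier χ D.dual i c⁻¹ := fun N p hp => by
  rw [hD.iterNat_dual_entry, map_inv₀, h N p hp, inv_pow]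

theorem IsEntryCohomologous.of_dual {χ : ℝ →*₀ ℝ} {c : ℝ}
    (h : IsEntryCohomologous χ D.dual i c⁻¹) (hD : D.IsDiagonal) :
    IsEntryCohomologous χ D i c := by
  obtain ⟨g, hg, hg0, hgD⟩ := h
  refine ⟨fun ω => (g ω)⁻¹, hg.inv₀ hg0, fun ω => inv_ne_zero (hg0 ω), fun ω => ?_⟩
  have hinv := congrArg (·⁻¹) (hgD ω)
  simpa only [LinCocycle.dual, contragredient_entry_of_isDiag (hD ω), map_inv₀, mul_inv_rev,
    inv_inv, mul_comm] using hinv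

namespace IsDiagonalFrame

theorem isEntryCohomologous_of_dominated [NeZero κ] (h : IsDiagonalFrame A C D)
    (hA : A.IsLocConst) (hdom : ∀ j ≠ i, D.EntryDominates j i) {χ : ℝ →*₀ ℝ} (hχ : Continuous χ)
    {c : ℝ} (hper : HasPeriodicMultiplier χ D i c) : IsEntryCohomologous χ D i c :=
  (h.dual.isEntryCohomologous_of_dominating hA.dual (fun j hj => (hdom j hj).dual h.isDiagonal) hχ
    (hper.dual h.isDiagonal)).of_dual h.isDiagonal

end IsDiagonalFrame

theorem IsDiagonal.exists_prod_eq_one_of_isEntryCohomologous (hD : D.IsDiagonal) {χ : ℝ →*₀ ℝ}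
    {c : Fin d → ℝ} (hc : ∏ j, c j = 1) (k : Fin d)
    (h : ∀ j ≠ k, IsEntryCohomologous χ D j (c j)) :
    ∃ g : FullShift κ → Fin d → ℝ, Continuous g ∧ (∀ ω, ∏ j, g ω j = 1) ∧
      ∀ ω j, χ (D ω j j) * χ (g ω j) = c j * χ (g (shift ω) j) := by
  choose! f hf hf0 hfD using h
  let g : FullShift κ → Fin d → ℝ := fun ω =>
    Function.update (fun j => f j ω) k (∏ j ∈ Finset.univ.erase k, f j ω)⁻¹
  have hgk (ω : FullShift κ) : g ω k = (∏ j ∈ Finset.univ.erase k, f j ω)⁻¹ :=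
    Function.update_self ..
  have hgne {j : Fin d} (hj : j ≠ k) (ω : FullShift κ) : g ω j = f j ω :=
    Function.update_of_ne hj ..
  have hprod0 (ω : FullShift κ) : ∏ j ∈ Finset.univ.erase k, f j ω ≠ 0 :=
    Finset.prod_ne_zero_iff.mpr fun j hj => hf0 j (Finset.ne_of_mem_erase hj) ω
  have hprod (ω : FullShift κ) : ∏ j, g ω j = 1 := by
    rw [← Finset.mul_prod_erase _ _ (Finset.mem_univ k), hgk,
      Finset.prod_congr rfl fun j hj => hgne (Finset.ne_of_mem_erase hj) ω,
      inv_mul_cancel₀ (hprod0 ω)]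
  have hcoh {j : Fin d} (hj : j ≠ k) (ω : FullShift κ) :
      χ (D ω j j) * χ (g ω j) = c j * χ (g (shift ω) j) := by
    rw [hgne hj, hgne hj, hfD j hj]
  refine ⟨g, continuous_pi fun j => ?_, hprod, fun ω j => ?_⟩
  · rcases eq_or_ne j k with rfl | hj
    · simp only [hgk]
      exact (continuous_finsetProd _ fun i hi => hf i (Finset.ne_of_mem_erase hi)).inv₀ hprod0
    · simpa only [hgne hj] using hf j hj
  · rcases eq_or_ne j k with rfl | hj
    · refine eq_of_prod_eq_of_forall_ne (k := j) (f := fun i => χ (D ω i i) * χ (g ω i))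
        (g := fun i => c i * χ (g (shift ω) i)) ?_ ?_ fun i hi => hcoh hi ω
      · simp only [Finset.prod_mul_distrib, ← map_prod, hprod, prod_slEntry_of_isDiag (hD ω), hc,
          map_one]
      · simp only [Finset.prod_mul_distrib, ← map_prod, hprod, hc, map_one, mul_one, ne_eq,
          one_ne_zero, not_false_eq_true]
    · exact hcoh hj ω

namespace IsDiagonalFrame

theorem exists_rescaled (h : IsDiagonalFrame A C D) {g : FullShift κ → Fin d → ℝ}
    (hg : Continuous g) (hprod : ∀ ω, ∏ j, g ω j = 1) :
    ∃ S B : LinCocycle κ d, S.IsDiagonal ∧ IsDiagonalFrame A (C * S) B ∧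
      ∀ ω j, B ω j j * g (shift ω) j = D ω j j * g ω j := by
  let S : LinCocycle κ d := fun ω =>
    ⟨Matrix.diagonal (g ω), (Matrix.det_diagonal).trans (hprod ω)⟩
  have hS : Continuous S := hg.matrix_diagonal.subtype_mk _
  have hSdiag : S.IsDiagonal := fun ω => Matrix.isDiag_diagonal _
  have hSentry (ω : FullShift κ) (j : Fin d) : S ω j j = g ω j := Matrix.diagonal_apply_eq _ j
  have hSD (ω : FullShift κ) : ((S (shift ω))⁻¹ * D ω).1.IsDiag :=
    isDiag_mul (isDiag_slInv (hSdiag _)) (h.isDiagonal ω)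
  refine ⟨S, fun ω => (S (shift ω))⁻¹ * D ω * S ω, hSdiag, ⟨h.continuous_frame.mul hS,
    ((hS.comp continuous_shift).inv.mul h.continuous_diag).mul hS, fun ω => ?_,
    fun ω => isDiag_mul (hSD ω) (hSdiag ω)⟩, fun ω j => ?_⟩
  · simp only [Pi.mul_apply]
    rw [← mul_assoc, h.isTransfer ω]
    group
  · have hne : g (shift ω) j ≠ 0 := hSentry (shift ω) j ▸ slEntry_ne_zero_of_isDiag (hSdiag _) j
    rw [slEntry_mul_of_isDiag_left (hSD ω), slEntry_mul_of_isDiag_right (h.isDiagonal ω),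
      slEntry_inv_of_isDiag (hSdiag _), hSentry, hSentry]
    field_simp

theorem exists_of_isEntryCohomologous (h : IsDiagonalFrame A C D) {χ : ℝ →*₀ ℝ} {c : Fin d → ℝ}
    (hc : ∏ j, c j = 1) (k : Fin d) (hcoh : ∀ j ≠ k, IsEntryCohomologous χ D j (c j)) :
    ∃ S B : LinCocycle κ d, S.IsDiagonal ∧ IsDiagonalFrame A (C * S) B ∧
      ∀ ω j, χ (B ω j j) = c j := by
  obtain ⟨g, hg, hprod, hgD⟩ :=
    h.isDiagonal.exists_prod_eq_one_of_isEntryCohomologous hc k hcoh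
  obtain ⟨S, B, hS, hB, hentry⟩ := h.exists_rescaled hg hprod
  refine ⟨S, B, hS, hB, fun ω j => ?_⟩
  have hne : g (shift ω) j ≠ 0 := Finset.prod_ne_zero_iff.mp
    ((hprod (shift ω)).trans_ne one_ne_zero) j (Finset.mem_univ j)
  refine mul_right_cancel₀ ((map_ne_zero χ).mpr hne) ?_
  rw [← map_mul, hentry, map_mul, hgD]

end IsDiagonalFrame

theorem IsDiagonal.prod_eq_one_of_hasPeriodicMultiplier [NeZero κ] (hD : D.IsDiagonal)
    {χ : ℝ →*₀ ℝ} {c : Fin d → ℝ} (hper : ∀ j, HasPeriodicMultiplier χ D j (c j)) :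
    ∏ j, c j = 1 := by
  have hmul (j : Fin d) : c j = χ (LinCocycle.iterNat D 1 (constSeq 0) j j) := by
    rw [(hper j).map_iterNat_constSeq, pow_one]
  rw [Finset.prod_congr rfl fun j _ => hmul j, ← map_prod,
    prod_slEntry_of_isDiag (hD.iterNat 1 _), map_one]

theorem IsDiagonalFrame.exists_of_hasPeriodicMultiplier [NeZero κ] {A C D : LinCocycle κ 3}
    (h : IsDiagonalFrame A C D) (hA : A.IsLocConst)
    (hdom : ∀ i j : Fin 3, i < j → D.EntryDominates i j) {χ : ℝ →*₀ ℝ} (hχ : Continuous χ)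
    {c : Fin 3 → ℝ} (hper : ∀ i, HasPeriodicMultiplier χ D i (c i)) :
    ∃ S B : LinCocycle κ 3, S.IsDiagonal ∧ IsDiagonalFrame A (C * S) B ∧
      ∀ ω i, χ (B ω i i) = c i := by
  have hdominating : IsEntryCohomologous χ D 0 (c 0) :=
    h.isEntryCohomologous_of_dominating hA (fun j hj => hdom 0 j (Fin.pos_iff_ne_zero.mpr hj)) hχ
      (hper 0)
  have hdominated : IsEntryCohomologous χ D 2 (c 2) :=
    h.isEntryCohomologous_of_dominated hA
      (fun j hj => hdom j 2 (lt_of_le_of_ne (Fin.le_last j) hj)) hχ (hper 2)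
  refine h.exists_of_isEntryCohomologous (h.isDiagonal.prod_eq_one_of_hasPeriodicMultiplier hper) 1
    fun j hj => ?_
  fin_cases j
  exacts [hdominating, (hj rfl).elim, hdominated]

end LinCocycle

theorem tendsto_sub_of_eventually_eq {κ : ℕ} {φ : FullShift κ → ℝ} (hφ : Continuous φ) {ι : Type*}
    {l : Filter ι} {x y : ι → FullShift κ} (h : ∀ j, ∀ᶠ n in l, x n j = y n j) :
    Tendsto (fun n => φ (x n) - φ (y n)) l (𝓝 0) := by
  let _ : UniformSpace (Fin κ) := ⊥
  have hxy : Tendsto (fun n => (x n, y n)) l (uniformity (FullShift κ)) := by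
    rw [Pi.uniformity, tendsto_iInf]
    refine fun j => tendsto_comap_iff.mpr fun s hs => mem_map.mpr ?_
    filter_upwards [h j] with n hn
    simpa only [Set.mem_preimage, Function.comp_apply, hn] using refl_mem_uniformity hs
  have huc : UniformContinuous φ := CompactSpace.uniformContinuous_of_continuous hφ
  rw [tendsto_zero_iff_abs_tendsto_zero]
  exact tendsto_uniformity_iff_dist_tendsto_zero.mp (Tendsto.comp huc hxy)

theorem dense_setOf_tendsto_birkhoffAverage {κ : ℕ} {φ : FullShift κ → ℝ} (hφ : Continuous φ)
    {p : FullShift κ} {a : ℝ} (hp : Tendsto (birkhoffAverage ℝ shift φ · p) atTop (𝓝 a)) :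
    Dense {ω | Tendsto (birkhoffAverage ℝ shift φ · ω) atTop (𝓝 a)} := by
  refine (dense_setOf_eventually_future_eq p).mono ?_
  rintro ω ⟨m, hm⟩
  refine tendsto_birkhoffAverage_of_tendsto_sub (tendsto_sub_of_eventually_eq hφ fun j => ?_) hp
  filter_upwards [eventually_ge_atTop (m + j.natAbs)] with n hn
  rw [shift_iterate, shift_iterate, shiftBy_apply, shiftBy_apply]
  exact hm _ (by omega)

theorem eq_of_mul_eq_mul_of_abs_eq {d : ℕ} {P X Y : Matrix.SpecialLinearGroup (Fin d) ℝ}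
    (hX : X.1.IsDiag) (hY : Y.1.IsDiag) (hP : P * X = Y * P) (habs : ∀ i, |X i i| = |Y i i|)
    (hinj : Function.Injective fun i => |Y i i|) (i : Fin d) : X i i = Y i i := by
  obtain ⟨j, hj⟩ : ∃ j, P j i ≠ 0 := by
    by_contra! hzero
    exact P.det_ne_zero (Matrix.det_eq_zero_of_column_eq_zero i hzero)
  have hentry : (P * X) j i = (Y * P) j i := by rw [hP]
  rw [slEntry_mul_of_isDiag_right hX, slEntry_mul_of_isDiag_left hY, mul_comm] at hentry
  have hXY : X i i = Y j j := mul_right_cancel₀ hj hentry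
  have hij : i = j := hinj (by simp only [← habs, hXY])
  rw [hXY, hij]

namespace LinCocycle

variable {κ d : ℕ} {A B C D : LinCocycle κ d}

section ConstantModuli

variable (hB : B.IsDiagonal) {μ : Fin d → ℝ} (hμ : ∀ ω i, |B ω i i| = μ i)

include hB hμ

theorem IsDiagonal.abs_iterNat_entry (n : ℕ) (ω : FullShift κ) (i : Fin d) :
    |LinCocycle.iterNat B n ω i i| = μ i ^ n := by
  induction n with
  | zero => simp [iterNat_zero]
  | succ n ih =>
    rw [iterNat_succ, slEntry_mul_of_isDiag_left (hB _), abs_mul, ih, hμ, pow_succ']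

theorem IsDiagonal.abs_iter_entry (n : ℤ) (ω : FullShift κ) (i : Fin d) :
    |LinCocycle.iter B n ω i i| = μ i ^ n := by
  rcases n with n | n
  · exact (hB.abs_iterNat_entry hμ n ω i).trans (zpow_natCast _ _).symm
  · rw [LinCocycle.iter, slEntry_inv_of_isDiag (hB.iterNat _ _), abs_inv,
      hB.abs_iterNat_entry hμ, zpow_negSucc]

theorem IsDiagonal.hasExponent_slAct_single {l : Filter ℤ} (hl : l ≤ cofinite) (ω : FullShift κ)
    (i : Fin d) {t : ℝ} (ht : t ≠ 0) :
    HasExponent (fun n => slAct (LinCocycle.iter B n ω) (EuclideanSpace.single i t)) l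
      (Real.log (μ i)) := by
  rw [_root_.hasExponent_slAct_single_iff hl (hB.iter · ω) i ht]
  refine tendsto_const_nhds.congr' ?_
  filter_upwards [hl (eventually_cofinite_ne 0)] with n hn
  have hn' : (n : ℝ) ≠ 0 := Int.cast_ne_zero.mpr hn
  rw [Real.norm_eq_abs, hB.abs_iter_entry hμ, Real.log_zpow]
  field_simp

theorem IsDiagonal.lyapunovSpectrum_eq_range_log (hμinj : Function.Injective μ)
    (ω : FullShift κ) : lyapunovSpectrum B ω = Set.range fun i => Real.log (μ i) := by
  have hpos (i : Fin d) : 0 < μ i := hμ ω i ▸ abs_pos.mpr (slEntry_ne_zero_of_isDiag (hB ω) i)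
  exact hB.lyapunovSpectrum_eq_range
    (fun i j hij => hμinj (Real.log_injOn_pos (hpos i) (hpos j) hij))
    fun i => (hB.hasExponent_slAct_single_iff one_ne_zero).mp
      (hB.hasExponent_slAct_single hμ atTop_le_cofinite ω i one_ne_zero)

end ConstantModuli

theorem IsConstUpToSigns.exists_abs_entry_eq (hB : B.IsConstUpToSigns) :
    B.IsDiagonal ∧ ∃ μ : Fin d → ℝ, Function.Injective μ ∧ ∀ ω i, |B ω i i| = μ i := by
  obtain ⟨μ, -, hinj, hμ⟩ := hB
  refine ⟨fun ω i j hij => ?_, μ, hinj, fun ω i => ?_⟩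
  · simpa [hij] using hμ ω i j
  · rw [hμ, Matrix.diagonal_apply_eq]

theorem IsDiagonal.isConstUpToSigns [NeZero κ] (hB : B.IsDiagonal) {μ : Fin d → ℝ}
    (hinj : Function.Injective μ) (hμ : ∀ ω i, |B ω i i| = μ i) : B.IsConstUpToSigns := by
  refine ⟨μ, fun i => ?_, hinj, fun ω i j => ?_⟩
  · exact hμ (constSeq 0) i ▸ abs_pos.mpr (slEntry_ne_zero_of_isDiag (hB _) i)
  · rcases eq_or_ne i j with rfl | hij
    · rw [hμ, Matrix.diagonal_apply_eq]
    · rw [hB ω hij, Matrix.diagonal_apply_ne _ hij, abs_zero]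

theorem hasSimpleSpectrum_const {B₀ : Matrix.SpecialLinearGroup (Fin d) ℝ} (hB : B₀.1.IsDiag)
    (hinj : Function.Injective fun i => |B₀ i i|) :
    HasSimpleSpectrum fun _ : FullShift κ => B₀ := fun ω => by
  have hdiag : IsDiagonal fun _ : FullShift κ => B₀ := fun _ => hB
  have hpos (i : Fin d) : 0 < |B₀ i i| := abs_pos.mpr (slEntry_ne_zero_of_isDiag hB i)
  rw [hdiag.lyapunovSpectrum_eq_range_log (fun _ _ => rfl) hinj, Set.ncard_range_of_injective
    fun i j hij => hinj (Real.log_injOn_pos (hpos i) (hpos j) hij), Nat.card_fin]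

theorem ContCohomologous.cohomologous (h : A.ContCohomologous B) : A.Cohomologous B :=
  let ⟨C, _, hC⟩ := h
  ⟨C, hC⟩

theorem Cohomologous.lyapunovSpectrum_eq_of_mem_periodicPts (h : A.Cohomologous B)
    {p : FullShift κ} (hp : p ∈ Function.periodicPts shift) :
    lyapunovSpectrum A p = lyapunovSpectrum B p :=
  let ⟨_, hC⟩ := h
  (isTransfer_iff.mpr hC).lyapunovSpectrum_eq_of_mem_periodicPts hp

theorem Cohomologous.periodicSpectraAgree_iff (h : A.Cohomologous B) :
    A.PeriodicSpectraAgree ↔ B.PeriodicSpectraAgree :=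
  forall₂_congr fun p hp => forall₂_congr fun q hq => by
    rw [h.lyapunovSpectrum_eq_of_mem_periodicPts hp, h.lyapunovSpectrum_eq_of_mem_periodicPts hq]

theorem IsConstUpToSigns.periodicSpectraAgree (hB : B.IsConstUpToSigns) :
    B.PeriodicSpectraAgree := fun p _ q _ => by
  obtain ⟨hdiag, μ, hinj, hμ⟩ := hB.exists_abs_entry_eq
  rw [hdiag.lyapunovSpectrum_eq_range_log hμ hinj, hdiag.lyapunovSpectrum_eq_range_log hμ hinj]

theorem iterNat_const (B₀ : Matrix.SpecialLinearGroup (Fin d) ℝ) (n : ℕ) (ω : FullShift κ) :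
    iterNat (fun _ : FullShift κ => B₀) n ω = B₀ ^ n := by
  induction n with
  | zero => rfl
  | succ n ih => rw [iterNat_succ, ih, pow_succ']

theorem iter_const (B₀ : Matrix.SpecialLinearGroup (Fin d) ℝ) (n : ℤ) (ω : FullShift κ) :
    iter (fun _ : FullShift κ => B₀) n ω = B₀ ^ n := by
  rcases n with n | n
  · exact (iterNat_const B₀ n ω).trans (zpow_natCast B₀ n).symm
  · rw [iter, iterNat_const, zpow_negSucc]

theorem periodicSpectraAgree_const (B₀ : Matrix.SpecialLinearGroup (Fin d) ℝ) :
    PeriodicSpectraAgree fun _ : FullShift κ => B₀ := fun p _ q _ => by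
  have hfin : finiteExponent (fun _ => B₀) p = finiteExponent (fun _ => B₀) q := by
    funext v n
    simp only [finiteExponent, iter_const]
  simp only [lyapunovSpectrum, hfin]

theorem IsDiagonalFrame.mem_forwardIrregular (h : IsDiagonalFrame A C D) {ω : FullShift κ}
    {i : Fin d} (hω : ¬ ∃ a, Tendsto (birkhoffAverage ℝ shift (logEntry D i) · ω) atTop (𝓝 a)) :
    ω ∈ A.forwardIrregular := by
  refine ⟨slAct (C ω) (EuclideanSpace.single i 1), slAct_ne_zero _ (by simp), ?_⟩
  rintro ⟨a, ha⟩
  exact hω ⟨a, (h.isDiagonal.hasExponent_slAct_single_iff one_ne_zero).mp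
    ((h.isTransfer.hasExponent_iff (isCompact_range h.continuous_frame) (fun n => ⟨_, rfl⟩) _
      atTop_le_cofinite).mp ha)⟩

section PeriodicOrbits

variable {i j : Fin d} {N M : ℕ} {p q : FullShift κ}

theorem IsDiagonal.iterNat_mul_entry_of_isPeriodicPt (hD : D.IsDiagonal)
    (hp : Function.IsPeriodicPt shift N p) (k : ℕ) (i : Fin d) :
    LinCocycle.iterNat D (k * N) p i i = LinCocycle.iterNat D N p i i ^ k := by
  induction k with
  | zero => simp [iterNat_zero]
  | succ k ih =>
    rw [Nat.succ_mul, iterNat_add, slEntry_mul_of_isDiag_left (hD.iterNat _ _),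
      isPeriodicPt_shift_iff.mp hp, ih, pow_succ]

theorem EntryDominates.abs_iterNat_entry_lt (h : D.EntryDominates i j) (hD : D.IsDiagonal)
    (hN : 0 < N) (hp : Function.IsPeriodicPt shift N p) :
    |iterNat D N p j j| < |iterNat D N p i i| := by
  by_contra! hle
  have hpow := h.isLittleO (tendsto_id.atTop_mul_const' hN) fun _ => p
  simp only [id, hD.iterNat_mul_entry_of_isPeriodicPt hp] at hpow
  refine Asymptotics.isLittleO_irrefl (Frequently.of_forall fun k => ?_)
    (hpow.trans_isBigO (Asymptotics.isBigO_of_le _ fun k => ?_))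
  · exact pow_ne_zero k (slEntry_ne_zero_of_isDiag (hD.iterNat N p) j)
  · simpa only [norm_pow] using pow_le_pow_left₀ (norm_nonneg _) hle k

variable (hdom : ∀ i j, i < j → D.EntryDominates i j)

include hdom

theorem IsDiagonal.strictAnti_birkhoffAverage (hD : D.IsDiagonal) (hN : 0 < N)
    (hp : Function.IsPeriodicPt shift N p) :
    StrictAnti fun i => birkhoffAverage ℝ shift (logEntry D i) N p := fun i j hij => by
  simp only [birkhoffAverage, smul_eq_mul, ← hD.log_abs_iterNat_entry]
  have hpos : 0 < |LinCocycle.iterNat D N p j j| :=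
    abs_pos.mpr (slEntry_ne_zero_of_isDiag (hD.iterNat N p) j)
  have hlt := (hdom i j hij).abs_iterNat_entry_lt hD hN hp
  gcongr

namespace IsDiagonalFrame

variable (h : IsDiagonalFrame A C D)

include h

theorem lyapunovSpectrum_eq_range_of_isPeriodicPt (hN : 0 < N)
    (hp : Function.IsPeriodicPt shift N p) :
    lyapunovSpectrum A p = Set.range fun i => birkhoffAverage ℝ shift (logEntry D i) N p := by
  rw [h.isTransfer.lyapunovSpectrum_eq_of_mem_periodicPts ⟨N, hN, hp⟩]
  exact h.isDiagonal.lyapunovSpectrum_eq_range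
    (h.isDiagonal.strictAnti_birkhoffAverage hdom hN hp).injective
    fun i => tendsto_birkhoffAverage_of_isPeriodicPt hN hp

theorem lyapunovSpectrum_eq_iff_of_isPeriodicPt (hN : 0 < N)
    (hp : Function.IsPeriodicPt shift N p) (hM : 0 < M) (hq : Function.IsPeriodicPt shift M q) :
    lyapunovSpectrum A p = lyapunovSpectrum A q ↔ ∀ i,
      birkhoffAverage ℝ shift (logEntry D i) N p = birkhoffAverage ℝ shift (logEntry D i) M q := by
  rw [h.lyapunovSpectrum_eq_range_of_isPeriodicPt hdom hN hp,
    h.lyapunovSpectrum_eq_range_of_isPeriodicPt hdom hM hq,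
    (h.isDiagonal.strictAnti_birkhoffAverage hdom hN hp).range_inj
      (h.isDiagonal.strictAnti_birkhoffAverage hdom hM hq), funext_iff]

theorem hasPeriodicMultiplier_of_periodicSpectraAgree [NeZero κ] (hagree : A.PeriodicSpectraAgree)
    (i : Fin d) : HasPeriodicMultiplier absHom D i |D (constSeq 0) i i| := fun N p hp => by
  rcases N.eq_zero_or_pos with rfl | hN
  · simp [iterNat_zero]
  have hz : Function.IsPeriodicPt shift 1 (constSeq 0 : FullShift κ) :=
    isPeriodicPt_shift_iff.mpr (shiftBy_constSeq _ _)
  have hlog := (h.lyapunovSpectrum_eq_iff_of_isPeriodicPt hdom hN hp one_pos hz).mp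
    (hagree p ⟨N, hN, hp⟩ _ ⟨1, one_pos, hz⟩) i
  simp only [birkhoffAverage, ← h.isDiagonal.log_abs_iterNat_entry, iterNat_one, smul_eq_mul,
    Nat.cast_one, inv_one, one_mul] at hlog
  rw [inv_mul_eq_iff_eq_mul₀ (by exact_mod_cast hN.ne'), ← Real.log_pow] at hlog
  exact Real.log_injOn_pos
    (abs_pos.mpr (slEntry_ne_zero_of_isDiag (h.isDiagonal.iterNat N p) i))
    (pow_pos (abs_pos.mpr (slEntry_ne_zero_of_isDiag (h.isDiagonal _) i)) N) hlog

theorem residual_forwardIrregular (hagree : ¬ A.PeriodicSpectraAgree) :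
    A.forwardIrregular ∈ residual (FullShift κ) := by
  simp only [PeriodicSpectraAgree, not_forall] at hagree
  obtain ⟨p, ⟨N, hN, hp⟩, q, ⟨M, hM, hq⟩, hne⟩ := hagree
  rw [h.lyapunovSpectrum_eq_iff_of_isPeriodicPt hdom hN hp hM hq, not_forall] at hne
  obtain ⟨i, hi⟩ := hne
  have hφ := h.isDiagonal.continuous_logEntry h.continuous_diag i
  filter_upwards [residual_setOf_not_tendsto (continuous_birkhoffAverage continuous_shift hφ) hi
    (dense_setOf_tendsto_birkhoffAverage hφ (tendsto_birkhoffAverage_of_isPeriodicPt hN hp))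
    (dense_setOf_tendsto_birkhoffAverage hφ (tendsto_birkhoffAverage_of_isPeriodicPt hM hq))]
    with ω hω
  exact h.mem_forwardIrregular hω

end IsDiagonalFrame

end PeriodicOrbits

end LinCocycle

namespace LinCocycle

section Frames

variable {κ d : ℕ} {A B C D H S : LinCocycle κ d}
  {E : Fin d → FullShift κ → Submodule ℝ (EuclideanSpace ℝ (Fin d))}

theorem IsAdaptedFrame.mul_isDiagonal (hCE : IsAdaptedFrame C E) (hS : S.IsDiagonal) :
    IsAdaptedFrame (C * S) E := fun ω i => by
  rw [Pi.mul_apply, slAct_mul, slAct_single_of_isDiag (hS ω), map_smul]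
  exact (E i ω).smul_mem _ (hCE ω i)

theorem IsAdaptedFrame.exists_slAct_single_eq (hCE : IsAdaptedFrame C E) {i : Fin d}
    {ω : FullShift κ} (hrank : Module.finrank ℝ (E i ω) = 1) {v : EuclideanSpace ℝ (Fin d)}
    (hv : v ∈ E i ω) : ∃ t, slAct (C ω) (EuclideanSpace.single i t) = v := by
  have hne : (⟨_, hCE ω i⟩ : E i ω) ≠ 0 := fun h =>
    slAct_ne_zero (C ω) (v := EuclideanSpace.single i 1) (by simp) (congrArg Subtype.val h)
  obtain ⟨t, ht⟩ := (finrank_eq_one_iff_of_nonzero' _ hne).mp hrank ⟨v, hv⟩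
  have hsingle : EuclideanSpace.single i t = t • EuclideanSpace.single i (1 : ℝ) := by
    ext
    simp
  exact ⟨t, hsingle ▸ (map_smul _ _ _).trans (congrArg Subtype.val ht)⟩

theorem IsTransfer.inv_mul (h : IsTransfer H A B) (h' : IsTransfer C A D) :
    IsTransfer (H⁻¹ * C) B D := fun ω => by
  have hB : B ω = (H (shift ω))⁻¹ * (A ω * H ω) := by rw [h ω, inv_mul_cancel_left]
  simp only [Pi.mul_apply, Pi.inv_apply, hB, mul_assoc, mul_inv_cancel_left, h' ω]

theorem IsDiagonalFrame.contCohomologous (h : IsDiagonalFrame A C D) : A.ContCohomologous D :=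
  ⟨C, h.continuous_frame, isTransfer_iff.mp h.isTransfer⟩

theorem IsDiagonalFrame.isLyapunovTypical (h : IsDiagonalFrame A C B) (hCE : IsAdaptedFrame C E)
    {μ : Fin d → ℝ} (hμ : ∀ ω i, |B ω i i| = μ i) (hanti : StrictAnti μ) {ω : FullShift κ}
    (hrank : ∀ i, Module.finrank ℝ (E i ω) = 1)
    (hsplit : DirectSum.IsInternal fun i => E i ω) : A.IsLyapunovTypical ω := by
  have hpos (i : Fin d) : 0 < μ i :=
    hμ ω i ▸ abs_pos.mpr (slEntry_ne_zero_of_isDiag (h.isDiagonal ω) i)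
  refine ⟨d, (E · ω), fun i => Real.log (μ i), hsplit, fun i hbot => ?_,
    fun i j hij => Real.log_lt_log (hpos j) (hanti hij), fun i v hv hv0 => ?_⟩
  · exact one_ne_zero ((hrank i).symm.trans (Submodule.finrank_eq_zero.mpr hbot))
  · obtain ⟨t, rfl⟩ := hCE.exists_slAct_single_eq (hrank i) hv
    have ht : t ≠ 0 := fun ht =>
      hv0 ((congrArg _ ((PiLp.single_eq_zero_iff 2 i).mpr ht)).trans (map_zero (slAct (C ω))))
    have hlim {l : Filter ℤ} (hl : l ≤ cofinite) := (h.isTransfer.hasExponent_iff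
      (isCompact_range h.continuous_frame) (fun n => ⟨_, rfl⟩) _ hl).mpr
      (h.isDiagonal.hasExponent_slAct_single hμ hl ω i ht)
    exact ⟨hlim atTop_le_cofinite, hlim atBot_le_cofinite⟩

theorem IsDiagonalFrame.hasConstantOrientation {B₀ : Matrix.SpecialLinearGroup (Fin d) ℝ}
    (h : IsDiagonalFrame A C fun _ => B₀) (hCE : IsAdaptedFrame C E)
    (hB : B₀.1.IsDiag) : A.HasConstantOrientation E := fun i => by
  have hcont : Continuous fun ω => slAct (C ω) (EuclideanSpace.single i (1 : ℝ)) := by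
    have hcol : Continuous fun ω => WithLp.toLp 2 fun j => C ω j i :=
      (PiLp.continuous_toLp 2 _).comp
        (continuous_pi fun j => (continuous_slEntry j i).comp h.continuous_frame)
    refine hcol.congr fun ω => ?_
    ext j
    exact (slAct_single (C ω) i j).symm
  have hne : B₀ i i ≠ 0 := slEntry_ne_zero_of_isDiag hB i
  refine ⟨_, SignType.sign (B₀ i i), hcont, fun ω => ⟨hCE ω i, slAct_ne_zero _ (by simp)⟩, ?_,
    fun ω => ⟨|B₀ i i|, abs_pos.mpr hne, ?_⟩⟩
  · rcases hne.lt_or_gt with hlt | hlt <;> simp [hlt]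
  · rw [sign_mul_abs, ← slAct_mul, h.isTransfer ω, slAct_mul, slAct_single_of_isDiag hB, map_smul]

theorem exists_pos_slAct_iterNat_eq_smul {v : FullShift κ → EuclideanSpace ℝ (Fin d)} {s : ℝ}
    (hvs : ∀ ω, ∃ a : ℝ, 0 < a ∧ slAct (A ω) (v ω) = (s * a) • v (shift ω)) (n : ℕ)
    (ω : FullShift κ) :
    ∃ a : ℝ, 0 < a ∧ slAct (iterNat A n ω) (v ω) = (s ^ n * a) • v (shiftBy n ω) := by
  induction n with
  | zero => exact ⟨1, one_pos, by simp [iterNat_zero, slAct_one]⟩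
  | succ n ih =>
    obtain ⟨a, ha, hiter⟩ := ih
    obtain ⟨b, hb, hstep⟩ := hvs (shiftBy n ω)
    refine ⟨a * b, mul_pos ha hb, ?_⟩
    rw [iterNat_succ, slAct_mul, hiter, map_smul, hstep, smul_smul, shift_shiftBy, pow_succ,
      mul_mul_mul_comm, Nat.cast_succ]

theorem IsDiagonalFrame.iterNat_entry_eq_of_eigenvector (h : IsDiagonalFrame A C D)
    (hCE : IsAdaptedFrame C E) {i : Fin d} {N : ℕ} {p : FullShift κ}
    (hp : Function.IsPeriodicPt shift N p) (hrank : Module.finrank ℝ (E i p) = 1)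
    {v : EuclideanSpace ℝ (Fin d)} (hv : v ∈ E i p) (hv0 : v ≠ 0) {b : ℝ}
    (hb : slAct (LinCocycle.iterNat A N p) v = b • v) : LinCocycle.iterNat D N p i i = b := by
  obtain ⟨t, rfl⟩ := hCE.exists_slAct_single_eq hrank hv
  rw [← slAct_mul, h.isTransfer.iterNat, isPeriodicPt_shift_iff.mp hp, slAct_mul,
    slAct_single_of_isDiag (h.isDiagonal.iterNat N p), map_smul] at hb
  exact smul_left_injective ℝ hv0 hb

theorem IsFinestDominatedSplitting.residual_forwardIrregular [NeZero d]
    (hE : A.IsFinestDominatedSplitting E) (hA : Continuous A) (hagree : ¬ A.PeriodicSpectraAgree) :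
    A.forwardIrregular ∈ residual (FullShift κ) := by
  obtain ⟨C, D, h, -, hdom⟩ := hE.exists_isDiagonalFrame hA
  exact h.residual_forwardIrregular hdom hagree

theorem IsFinestDominatedSplitting.periodicSpectraAgree [NeZero κ] [NeZero d]
    (hE : A.IsFinestDominatedSplitting E) (hA : Continuous A) (hirr : A.forwardIrregular = ∅) :
    A.PeriodicSpectraAgree := by
  by_contra hagree
  exact (dense_of_mem_residual (hE.residual_forwardIrregular hA hagree)).nonempty.ne_empty hirr

end Frames

section Multipliers

variable {κ d : ℕ} {A C D : LinCocycle κ d} {i : Fin d} {c : ℝ}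

theorem HasPeriodicMultiplier.abs (h : HasPeriodicMultiplier (MonoidWithZeroHom.id ℝ) D i c) :
    HasPeriodicMultiplier absHom D i |c| := fun N p hp =>
  (congrArg absHom (h N p hp)).trans (map_pow absHom c N)

theorem IsDiagonal.strictAnti_of_hasPeriodicMultiplier [NeZero κ] (hD : D.IsDiagonal)
    (hdom : ∀ i j, i < j → D.EntryDominates i j) {c : Fin d → ℝ}
    (hper : ∀ i, HasPeriodicMultiplier absHom D i (c i)) : StrictAnti c := fun i j hij => by
  have hlt := (hdom i j hij).abs_iterNat_entry_lt hD one_pos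
    (p := constSeq 0) (isPeriodicPt_shift_iff.mpr (shiftBy_constSeq _ _))
  have hmult (k : Fin d) : |LinCocycle.iterNat D 1 (constSeq 0) k k| = c k :=
    ((hper k).map_iterNat_constSeq 0 1).trans (pow_one _)
  rwa [hmult, hmult] at hlt

theorem IsDiagonalFrame.hasPeriodicMultiplier_of_orientation
    {E : Fin d → FullShift κ → Submodule ℝ (EuclideanSpace ℝ (Fin d))}
    (h : IsDiagonalFrame A C D) (hCE : IsAdaptedFrame C E)
    (hrank : ∀ ω, Module.finrank ℝ (E i ω) = 1) {v : FullShift κ → EuclideanSpace ℝ (Fin d)}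
    (hv : ∀ ω, v ω ∈ E i ω ∧ v ω ≠ 0) {s : ℝ} (hs : |s| = 1)
    (hvs : ∀ ω, ∃ a : ℝ, 0 < a ∧ slAct (A ω) (v ω) = (s * a) • v (shift ω))
    (hper : HasPeriodicMultiplier absHom D i c) :
    HasPeriodicMultiplier (MonoidWithZeroHom.id ℝ) D i (s * c) := fun N p hp => by
  obtain ⟨a, ha, hiter⟩ := exists_pos_slAct_iterNat_eq_smul hvs N p
  rw [isPeriodicPt_shift_iff.mp hp] at hiter
  have hentry := h.iterNat_entry_eq_of_eigenvector hCE hp (hrank p) (hv p).1 (hv p).2 hiter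
  have habs : |LinCocycle.iterNat D N p i i| = c ^ N := hper N p hp
  rw [hentry, abs_mul, abs_pow, hs, one_pow, one_mul, abs_of_pos ha] at habs
  rw [MonoidWithZeroHom.id_apply, hentry, habs, mul_pow]

theorem IsDiagonalFrame.hasPeriodicMultiplier_of_cohomologous_const [NeZero κ]
    (h : IsDiagonalFrame A C D) (hdom : ∀ i j, i < j → D.EntryDominates i j)
    {B₀ : Matrix.SpecialLinearGroup (Fin d) ℝ} (hAB : A.Cohomologous fun _ => B₀) (i : Fin d) :
    HasPeriodicMultiplier (MonoidWithZeroHom.id ℝ) D i (D (constSeq 0) i i) := fun N p hp => by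
  rcases N.eq_zero_or_pos with rfl | hN
  · simp [iterNat_zero]
  have habs := h.hasPeriodicMultiplier_of_periodicSpectraAgree hdom
    (hAB.periodicSpectraAgree_iff.mpr (periodicSpectraAgree_const B₀))
  have hz (n : ℕ) : Function.IsPeriodicPt shift n (constSeq 0 : FullShift κ) :=
    isPeriodicPt_shift_iff.mpr (shiftBy_constSeq _ _)
  obtain ⟨H, hH⟩ := hAB
  have hQ := (isTransfer_iff.mpr hH).inv_mul h.isTransfer
  have hconj {q : FullShift κ} (hq : Function.IsPeriodicPt shift N q) :
      B₀ ^ N * (H⁻¹ * C) q = (H⁻¹ * C) q * LinCocycle.iterNat D N q := by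
    rw [← iterNat_const B₀ N q, hQ.iterNat, isPeriodicPt_shift_iff.mp hq]
  have hP : (((H⁻¹ * C) (constSeq 0))⁻¹ * (H⁻¹ * C) p) * LinCocycle.iterNat D N p =
      LinCocycle.iterNat D N (constSeq 0) * (((H⁻¹ * C) (constSeq 0))⁻¹ * (H⁻¹ * C) p) := by
    rw [mul_assoc, ← hconj hp, ← mul_assoc, ← mul_assoc, mul_left_inj, inv_mul_eq_iff_eq_mul,
      ← mul_assoc, ← hconj (hz N), mul_inv_cancel_right]
  have hanti : StrictAnti fun i => |LinCocycle.iterNat D N (constSeq 0) i i| := fun i j hij =>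
    (hdom i j hij).abs_iterNat_entry_lt h.isDiagonal hN (hz N)
  have hpow := h.isDiagonal.iterNat_mul_entry_of_isPeriodicPt (hz 1) N i
  rw [mul_one, iterNat_one] at hpow
  exact (eq_of_mul_eq_mul_of_abs_eq (h.isDiagonal.iterNat N p)
    (h.isDiagonal.iterNat N (constSeq 0)) hP
    (fun i => (habs i N p hp).trans (habs i N _ (hz N)).symm) hanti.injective i).trans hpow

end Multipliers

section Dichotomy

variable {κ : ℕ} [NeZero κ] {A C D : LinCocycle κ 3}
  {E : Fin 3 → FullShift κ → Submodule ℝ (EuclideanSpace ℝ (Fin 3))}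

theorem IsDiagonalFrame.exists_const_of_hasPeriodicMultiplier (h : IsDiagonalFrame A C D)
    (hA : A.IsLocConst) (hdom : ∀ i j, i < j → D.EntryDominates i j) (hCE : IsAdaptedFrame C E)
    {c : Fin 3 → ℝ} (hper : ∀ i, HasPeriodicMultiplier (MonoidWithZeroHom.id ℝ) D i (c i)) :
    ∃ (C' : LinCocycle κ 3) (B₀ : Matrix.SpecialLinearGroup (Fin 3) ℝ), B₀.1.IsDiag ∧
      IsDiagonalFrame A C' (fun _ => B₀) ∧ IsAdaptedFrame C' E ∧
      HasSimpleSpectrum fun _ : FullShift κ => B₀ := by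
  obtain ⟨S, B, hS, hB, hBc⟩ := h.exists_of_hasPeriodicMultiplier hA hdom continuous_id hper
  have hconst : B = fun _ => B (constSeq 0) := by
    funext ω
    ext i j
    rcases eq_or_ne i j with rfl | hij
    · exact (hBc ω i).trans (hBc _ i).symm
    · rw [hB.isDiagonal ω hij, hB.isDiagonal _ hij]
  have hanti := h.isDiagonal.strictAnti_of_hasPeriodicMultiplier hdom fun i => (hper i).abs
  refine ⟨C * S, B (constSeq 0), hB.isDiagonal _, hconst ▸ hB, hCE.mul_isDiagonal hS,
    hasSimpleSpectrum_const (hB.isDiagonal _) ?_⟩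
  have hentry : (fun i => |B (constSeq 0) i i|) = fun i => |c i| :=
    funext fun i => congrArg abs (hBc _ i)
  exact hentry ▸ hanti.injective

namespace IsFinestDominatedSplitting

variable (hE : A.IsFinestDominatedSplitting E) (hA : A.IsLocConst)

include hE hA

theorem exists_isDiagonalFrame_abs_eq (hagree : A.PeriodicSpectraAgree) :
    ∃ (C B : LinCocycle κ 3) (μ : Fin 3 → ℝ), IsDiagonalFrame A C B ∧ IsAdaptedFrame C E ∧
      StrictAnti μ ∧ ∀ ω i, |B ω i i| = μ i := by
  obtain ⟨C, D, h, hCE, hdom⟩ := hE.exists_isDiagonalFrame hA.continuous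
  have hper := h.hasPeriodicMultiplier_of_periodicSpectraAgree hdom hagree
  obtain ⟨S, B, hS, hB, hBμ⟩ := h.exists_of_hasPeriodicMultiplier hA hdom continuous_abs hper
  exact ⟨C * S, B, _, hB, hCE.mul_isDiagonal hS,
    h.isDiagonal.strictAnti_of_hasPeriodicMultiplier hdom hper, hBμ⟩

theorem nonTypical_eq_empty (hagree : A.PeriodicSpectraAgree) : A.nonTypical = ∅ := by
  obtain ⟨C, B, μ, hB, hCE, hanti, hμ⟩ := hE.exists_isDiagonalFrame_abs_eq hA hagree
  exact Set.eq_empty_of_forall_notMem fun ω hω =>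
    hω (hB.isLyapunovTypical hCE hμ hanti (hE.one_dim · ω) (hE.splits ω))

theorem exists_isConstUpToSigns_contCohomologous (hagree : A.PeriodicSpectraAgree) :
    ∃ B : LinCocycle κ 3, B.IsConstUpToSigns ∧ A.ContCohomologous B := by
  obtain ⟨C, B, μ, hB, -, hanti, hμ⟩ := hE.exists_isDiagonalFrame_abs_eq hA hagree
  exact ⟨B, hB.isDiagonal.isConstUpToSigns hanti.injective hμ, hB.contCohomologous⟩

theorem exists_const_contCohomologous (hor : A.HasConstantOrientation E)
    (hagree : A.PeriodicSpectraAgree) :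
    ∃ B₀ : Matrix.SpecialLinearGroup (Fin 3) ℝ, HasSimpleSpectrum (fun _ : FullShift κ => B₀) ∧
      A.ContCohomologous fun _ => B₀ := by
  obtain ⟨C, D, h, hCE, hdom⟩ := hE.exists_isDiagonalFrame hA.continuous
  choose v s _ hv hs hvs using hor
  have hper (i : Fin 3) := h.hasPeriodicMultiplier_of_orientation hCE (hE.one_dim i) (hv i)
    (by rcases hs i with hi | hi <;> simp [hi]) (hvs i)
    (h.hasPeriodicMultiplier_of_periodicSpectraAgree hdom hagree i)
  obtain ⟨C', B₀, -, hB, -, hsimple⟩ := h.exists_const_of_hasPeriodicMultiplier hA hdom hCE hper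
  exact ⟨B₀, hsimple, hB.contCohomologous⟩

theorem hasConstantOrientation_of_cohomologous_const {B₀ : Matrix.SpecialLinearGroup (Fin 3) ℝ}
    (hAB : A.Cohomologous fun _ => B₀) : A.HasConstantOrientation E := by
  obtain ⟨C, D, h, hCE, hdom⟩ := hE.exists_isDiagonalFrame hA.continuous
  obtain ⟨C', B₁, hdiag, hB, hCE', -⟩ := h.exists_const_of_hasPeriodicMultiplier hA hdom hCE
    (h.hasPeriodicMultiplier_of_cohomologous_const hdom hAB)
  exact hB.hasConstantOrientation hCE' hdiag

end IsFinestDominatedSplitting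

end Dichotomy

end LinCocycle

theorem mainTheorem8 (κ : ℕ) (hκ : 1 ≤ κ) (A : LinCocycle κ 3) (hA : A.IsLocConst)
    (E : Fin 3 → FullShift κ → Submodule ℝ (EuclideanSpace ℝ (Fin 3)))
    (hE : A.IsFinestDominatedSplitting E) :
    List.TFAE [
      A.nonTypical = ∅,
      A.forwardIrregular = ∅,
      A.PeriodicSpectraAgree,
      ∃ B : LinCocycle κ 3, B.IsConstUpToSigns ∧ A.ContCohomologous B,
      ∃ B : LinCocycle κ 3, B.IsConstUpToSigns ∧ A.Cohomologous B] ∧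
    List.TFAE [
      A.HasConstantOrientation E ∧ A.nonTypical = ∅,
      ∃ B₀ : Matrix.SpecialLinearGroup (Fin 3) ℝ,
        LinCocycle.HasSimpleSpectrum (fun _ : FullShift κ => B₀) ∧
        A.ContCohomologous (fun _ => B₀),
      ∃ B₀ : Matrix.SpecialLinearGroup (Fin 3) ℝ,
        LinCocycle.HasSimpleSpectrum (fun _ : FullShift κ => B₀) ∧
        A.Cohomologous (fun _ => B₀)] ∧
    (A.nonTypical.Nonempty →
      A.forwardIrregular ∈ residual (FullShift κ) ∧ A.nonTypical ∈ residual (FullShift κ)) := by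
  have : NeZero κ := ⟨by omega⟩
  have hirr (hempty : A.nonTypical = ∅) : A.forwardIrregular = ∅ :=
    Set.subset_eq_empty A.forwardIrregular_subset_nonTypical hempty
  refine ⟨?_, ?_, fun hne => ?_⟩
  · tfae_have 1 → 2 := hirr
    tfae_have 2 → 3 := hE.periodicSpectraAgree hA.continuous
    tfae_have 3 → 1 := hE.nonTypical_eq_empty hA
    tfae_have 3 → 4 := hE.exists_isConstUpToSigns_contCohomologous hA
    tfae_have 4 → 5 := fun ⟨B, hB, hAB⟩ => ⟨B, hB, hAB.cohomologous⟩
    tfae_have 5 → 3 := fun ⟨_, hB, hAB⟩ => hAB.periodicSpectraAgree_iff.mpr hB.periodicSpectraAgree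
    tfae_finish
  · tfae_have 1 → 2 := fun ⟨hor, hempty⟩ =>
      hE.exists_const_contCohomologous hA hor (hE.periodicSpectraAgree hA.continuous (hirr hempty))
    tfae_have 2 → 3 := fun ⟨B₀, hB, hAB⟩ => ⟨B₀, hB, hAB.cohomologous⟩
    tfae_have 3 → 1 := fun ⟨B₀, _, hAB⟩ =>
      ⟨hE.hasConstantOrientation_of_cohomologous_const hA hAB, hE.nonTypical_eq_empty hA
        (hAB.periodicSpectraAgree_iff.mpr (LinCocycle.periodicSpectraAgree_const B₀))⟩
    tfae_finish
  · have hres := hE.residual_forwardIrregular hA.continuous fun hagree =>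
      hne.ne_empty (hE.nonTypical_eq_empty hA hagree)
    exact ⟨hres, mem_of_superset hres A.forwardIrregular_subset_nonTypical⟩
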